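/- Let $(\mathcal C,\otimes,\mathbf I)$ be an additive monoidal category (additive, with $\otimes$ biadditive on morphisms; associativity and unit isomorphisms are suppressed below). A \emph{braided system} of rank $r$ in $\mathcal C$ is a family of objects $V_1,\dots,V_r$ with morphisms $\sigma_{i,j}:V_i\otimes V_j\to V_j\otimes V_i$ for $i\le j$ such that, for all $i\le j\le k$, $$(\sigma_{j,k}\otimes \mathrm{Id})\circ(\mathrm{Id}\otimes \sigma_{i,k})\circ(\sigma_{i,j}\otimes \mathrm{Id}) =(\mathrm{Id}\otimes \sigma_{i,j})\circ(\sigma_{i,k}\otimes \mathrm{Id})\circ(\mathrm{Id}\otimes \sigma_{j,k})\quad\text{on } V_i\otimes V_j\otimes V_k .$$ A \emph{right braided module} over it is an object $M$ with morphisms $\rho_i:M\otimes V_i\to M$ such that $\rho_j\circ(\rho_i\otimes\mathrm{Id}_{V_j})=\rho_i\circ(\rho_j\otimes\mathrm{Id}_{V_i})\circ(\mathrm{Id}_M\otimes\sigma_{i,j})$ for all $i\le j$. A \emph{left braided module} is an object $N$ with morphisms $\lambda_i:V_i\otimes N\to N$ such that $\lambda_i\circ(\mathrm{Id}_{V_i}\otimes\lambda_j)=\lambda_j\circ(\mathrm{Id}_{V_j}\otimes\lambda_i)\circ(\sigma_{i,j}\otimes\mathrm{Id}_N)$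 for all $i\le j$. Put $V=V_1\oplus\cdots\oplus V_r$ and let $\rho:M\otimes V\to M$ and $\lambda:V\otimes N\to N$ be the morphisms with components $\rho_i$ and $\lambda_i$. Let $T(\overline V)_n^\rightarrow$ be the direct sum of all $V_{k_1}\otimes\cdots\otimes V_{k_n}$ with $k_1\le\dots\le k_n$, a direct summand of $V^{\otimes n}$; thus $T(\overline V)_0^\rightarrow=\mathbf I$ and $T(\overline V)_1^\rightarrow=V$. For $\theta\in S_n$ let $B_\theta=\sigma_{i_1}\cdots\sigma_{i_k}$ be the element of the positive braid monoid $B_n^+$ given by any shortest word $s_{i_1}\cdots s_{i_k}$ for $\theta$ in the transpositions $s_i=(i,i+1)$. Let $b\mapsto b^{\overline\sigma}$ be the partial action of $B_n^+$ on $V^{\otimes n}$ in which the generator $\sigma_i$ applies $\sigma_{k_i,k_{i+1}}$ to the $i$-th and $(i+1)$-st factors of $V_{k_1}\otimes\cdots\otimes V_{k_n}$, defined when $k_i\le k_{i+1}$. For $p+q=n$ let $Sh_{p,q}\subset S_n$ be the set of $\theta$ with $\theta(1)<\dots<\theta(p)$ and $\theta(p+1)<\dots<\theta(n)$. The \emph{multi-quantum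 coshuffle comultiplication} is $$\Delta^{\overline\sigma}_{p,q}=\sum_{\theta\in Sh_{p,q}}(B_{\theta^{-1}})^{\overline\sigma}\;:\;T(\overline V)_{p+q}^\rightarrow\to T(\overline V)_p^\rightarrow\otimes T(\overline V)_q^\rightarrow .$$ Let $-\overline\sigma$ denote the braiding $(-\sigma_{i,j})_{i\le j}$ on the same objects. \textbf{Theorem.} Let $(\overline V,\overline\sigma)$ be a braided system in an additive monoidal category $\mathcal C$, with a right braided module $(M,\overline\rho)$ and a left braided module $(N,\overline\lambda)$. For $n\ge 1$ define morphisms from $M\otimes T(\overline V)_n^\rightarrow\otimes N$ to $M\otimes T(\overline V)_{n-1}^\rightarrow\otimes N$ by $$({}^{\rho}d)_n=(\rho\otimes\mathrm{Id}_{T(\overline V)_{n-1}^\rightarrow\otimes N})\circ(\mathrm{Id}_M\otimes\Delta^{-\overline\sigma}_{1,n-1}\otimes\mathrm{Id}_N),$$ $$(d^{\lambda})_n=(-1)^{n-1}(\mathrm{Id}_{M\otimes T(\overline V)_{n-1}^\rightarrow}\otimes\lambda)\circ(\mathrm{Id}_M\otimes\Delta^{-\overline\sigma}_{n-1,1}\otimes\mathrm{Id}_N).$$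 These two families form a bidifferential: for all $n\ge 2$, $$({}^{\rho}d)_{n-1}\circ({}^{\rho}d)_n=0,\qquad (d^{\lambda})_{n-1}\circ(d^{\lambda})_n=0,\qquad (d^{\lambda})_{n-1}\circ({}^{\rho}d)_n+({}^{\rho}d)_{n-1}\circ(d^{\lambda})_n=0 .$$ Consequently, for all $a,b\in\mathbb Z$, the family $d_n=a\,({}^{\rho}d)_n+b\,(d^{\lambda})_n$ is a differential, i.e. $d_{n-1}\circ d_n=0$ for all $n\ge 2$. -/

import Mathlib

open CategoryTheory CategoryTheory.Limits CategoryTheory.MonoidalCategory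

noncomputable section

namespace MultiBraided

universe v u

/-! ### Permutations, positive braids and shuffles -/

/-- The elementary transposition `s_i = (i, i+1)` of `{0, …, n-1}`, for `0 ≤ i < n - 1`. -/
def simpleTransposition (n : ℕ) (i : Fin (n - 1)) : Equiv.Perm (Fin n) :=
  Equiv.swap ⟨i.1, by omega⟩ ⟨i.1 + 1, by omega⟩

/-- The permutation `s_{i_1} s_{i_2} ⋯ s_{i_k}` represented by a word in the generators. -/
def wordPerm (n : ℕ) : FreeMonoid (Fin (n - 1)) →* Equiv.Perm (Fin n) :=
  FreeMonoid.lift (simpleTransposition n)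

/-- The defining relations of the positive braid monoid. -/
inductive BraidRel (n : ℕ) : FreeMonoid (Fin (n - 1)) → FreeMonoid (Fin (n - 1)) → Prop
  | far (i j : Fin (n - 1)) (h : i.1 + 1 < j.1) :
      BraidRel n (FreeMonoid.of i * FreeMonoid.of j) (FreeMonoid.of j * FreeMonoid.of i)
  | braid (i j : Fin (n - 1)) (h : i.1 + 1 = j.1) :
      BraidRel n (FreeMonoid.of i * FreeMonoid.of j * FreeMonoid.of i)
        (FreeMonoid.of j * FreeMonoid.of i * FreeMonoid.of j)

/-- The positive braid monoid `B_n^+`. -/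
abbrev PositiveBraidMonoid (n : ℕ) : Type := PresentedMonoid (BraidRel n)

/-- Every permutation is represented by a word of minimal length. -/
theorem exists_shortestWord {n : ℕ} (θ : Equiv.Perm (Fin n)) :
    ∃ l : FreeMonoid (Fin (n - 1)), wordPerm n l = θ ∧
      ∀ l' : FreeMonoid (Fin (n - 1)), wordPerm n l' = θ → l.length ≤ l'.length := by
  have hs : ∃ l : FreeMonoid (Fin (n - 1)), wordPerm n l = θ := by
    cases n with
    | zero => exact ⟨1, Subsingleton.elim _ _⟩
    | succ m =>
      have h : MonoidHom.mrange (wordPerm (m + 1)) = ⊤ := by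
        rw [wordPerm, FreeMonoid.mrange_lift]
        exact Equiv.Perm.mclosure_swap_castSucc_succ m
      have h' : θ ∈ MonoidHom.mrange (wordPerm (m + 1)) := by rw [h]; trivial
      exact h'
  classical
  have hk : ∃ k, ∃ l : FreeMonoid (Fin (n - 1)), wordPerm n l = θ ∧ l.length = k := by
    obtain ⟨l, hl⟩ := hs
    exact ⟨_, l, hl, rfl⟩
  obtain ⟨l, hl, hlen⟩ := Nat.find_spec hk
  exact ⟨l, hl, fun l' hl' => hlen ▸ Nat.find_min' hk ⟨l', hl', rfl⟩⟩

/-- A shortest word representing the permutation `θ`. -/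
def shortestWord {n : ℕ} (θ : Equiv.Perm (Fin n)) : FreeMonoid (Fin (n - 1)) :=
  (exists_shortestWord θ).choose

/-- The positive braid `B_θ`: the image of `θ` under the Matsumoto section `S_n → B_n^+`. -/
def matsumoto {n : ℕ} (θ : Equiv.Perm (Fin n)) : PositiveBraidMonoid n :=
  PresentedMonoid.mk (BraidRel n) (shortestWord θ)

open Classical in
/-- The shuffle set `Sh_{p,q}`, as a set of permutations of `{0, …, n-1}`, where `n = p + q`:
the permutations increasing on the first `p` and on the last `q` elements. -/
def shuffles (p n : ℕ) : Finset (Equiv.Perm (Fin n)) :=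
  Finset.univ.filter fun θ =>
    StrictMonoOn θ {i | i.1 < p} ∧ StrictMonoOn θ {i | p ≤ i.1}

variable {C : Type u} [Category.{v} C] [MonoidalCategory C]

/-! ### Tensor powers and the action of positive braids -/

/-- The tensor power `X^{⊗ n}`, with `X^{⊗ (n+1)} = X^{⊗ n} ⊗ X`. -/
def tensorPow (X : C) : ℕ → C
  | 0 => 𝟙_ C
  | n + 1 => tensorPow X n ⊗ X

/-- The canonical isomorphism `X^{⊗ (p+q)} ≅ X^{⊗ p} ⊗ X^{⊗ q}`. -/
def tensorPowAdd (X : C) (p : ℕ) : (q : ℕ) → (tensorPow X (p + q) ≅ tensorPow X p ⊗ tensorPow X q)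
  | 0 => (ρ_ (tensorPow X p)).symm
  | q + 1 => whiskerRightIso (tensorPowAdd X p q) X ≪≫ α_ _ _ _

/-- The canonical isomorphism `X^{⊗ n} ≅ X^{⊗ p} ⊗ X^{⊗ q}`, for `n = p + q`. -/
def tensorPowSplit (X : C) (p q : ℕ) {n : ℕ} (h : p + q = n) :
    tensorPow X n ≅ tensorPow X p ⊗ tensorPow X q :=
  eqToIso (by rw [h]) ≪≫ tensorPowAdd X p q

/-- The (uncolored) Yang-Baxter equation for an endomorphism of `X ⊗ X`. -/
def YangBaxter {X : C} (c : X ⊗ X ⟶ X ⊗ X) : Prop :=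
  c ▷ X ≫ (α_ X X X).hom ≫ X ◁ c ≫ (α_ X X X).inv ≫ c ▷ X =
    (α_ X X X).hom ≫ X ◁ c ≫ (α_ X X X).inv ≫ c ▷ X ≫ (α_ X X X).hom ≫ X ◁ c ≫ (α_ X X X).inv

/-- The endomorphism `Id^{⊗ i} ⊗ c ⊗ Id^{⊗ (n-i-2)}` of `X^{⊗ n}`, for `0 ≤ i < n - 1`. -/
def braidGen {X : C} (c : X ⊗ X ⟶ X ⊗ X) :
    (n : ℕ) → Fin (n - 1) → (tensorPow X n ⟶ tensorPow X n)
  | 0 => fun i => i.elim0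
  | 1 => fun i => i.elim0
  | n + 2 => Fin.lastCases (motive := fun _ => (tensorPow X n ⊗ X) ⊗ X ⟶ (tensorPow X n ⊗ X) ⊗ X)
      ((α_ (tensorPow X n) X X).hom ≫ tensorPow X n ◁ c ≫ (α_ (tensorPow X n) X X).inv)
      (fun i : Fin n => braidGen c (n + 1) i ▷ X)

theorem braidGen_last {X : C} (c : X ⊗ X ⟶ X ⊗ X) (n : ℕ) :
    braidGen c (n + 2) (Fin.last n) =
      (α_ (tensorPow X n) X X).hom ≫ tensorPow X n ◁ c ≫ (α_ (tensorPow X n) X X).inv :=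
  Fin.lastCases_last ..

theorem braidGen_castSucc {X : C} (c : X ⊗ X ⟶ X ⊗ X) (n : ℕ) (i : Fin n) :
    braidGen c (n + 2) i.castSucc = braidGen c (n + 1) i ▷ X :=
  Fin.lastCases_castSucc ..

theorem far_aux {X Y : C} (c : X ⊗ X ⟶ X ⊗ X) (f : Y ⟶ Y) :
    f ▷ X ▷ X ≫ (α_ Y X X).hom ≫ Y ◁ c ≫ (α_ Y X X).inv =
      ((α_ Y X X).hom ≫ Y ◁ c ≫ (α_ Y X X).inv) ≫ f ▷ X ▷ X := by
  rw [associator_naturality_left_assoc, ← whisker_exchange_assoc, associator_inv_naturality_left]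
  simp only [Category.assoc]

theorem braid_aux {X : C} {c : X ⊗ X ⟶ X ⊗ X} (h : YangBaxter c) (Y : C) :
    ((α_ Y X X).hom ≫ Y ◁ c ≫ (α_ Y X X).inv) ▷ X ≫
        ((α_ (Y ⊗ X) X X).hom ≫ (Y ⊗ X) ◁ c ≫ (α_ (Y ⊗ X) X X).inv) ≫
          ((α_ Y X X).hom ≫ Y ◁ c ≫ (α_ Y X X).inv) ▷ X =
      ((α_ (Y ⊗ X) X X).hom ≫ (Y ⊗ X) ◁ c ≫ (α_ (Y ⊗ X) X X).inv) ≫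
        ((α_ Y X X).hom ≫ Y ◁ c ≫ (α_ Y X X).inv) ▷ X ≫
          ((α_ (Y ⊗ X) X X).hom ≫ (Y ⊗ X) ◁ c ≫ (α_ (Y ⊗ X) X X).inv) := by
  have key : Y ◁ (c ▷ X ≫ (α_ X X X).hom ≫ X ◁ c ≫ (α_ X X X).inv ≫ c ▷ X) = Y ◁ _ :=
    congrArg (Y ◁ ·) h
  have key' := (α_ Y X X).hom ▷ X ≫= (α_ Y (X ⊗ X) X).hom ≫= key
  have key'' := (key' =≫ (α_ Y (X ⊗ X) X).inv) =≫ (α_ Y X X).inv ▷ X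
  have e₁ : ((α_ Y X X).hom ≫ Y ◁ c ≫ (α_ Y X X).inv) ▷ X =
      (α_ Y X X).hom ▷ X ≫ (α_ Y (X ⊗ X) X).hom ≫ Y ◁ (c ▷ X) ≫ (α_ Y (X ⊗ X) X).inv ≫
        (α_ Y X X).inv ▷ X := by
    monoidal
  have e₂ : (α_ (Y ⊗ X) X X).hom ≫ (Y ⊗ X) ◁ c ≫ (α_ (Y ⊗ X) X X).inv =
      (α_ Y X X).hom ▷ X ≫ (α_ Y (X ⊗ X) X).hom ≫ Y ◁ ((α_ X X X).hom ≫ X ◁ c ≫ (α_ X X X).inv) ≫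
        (α_ Y (X ⊗ X) X).inv ≫ (α_ Y X X).inv ▷ X := by
    monoidal
  rw [e₁, e₂]
  simpa using key''

theorem braidGen_far {X : C} (c : X ⊗ X ⟶ X ⊗ X) : (n : ℕ) → (i j : Fin (n - 1)) →
    i.1 + 1 < j.1 → braidGen c n i ≫ braidGen c n j = braidGen c n j ≫ braidGen c n i
  | 0, i, _, _ => i.elim0
  | 1, i, _, _ => i.elim0
  | 2, i, j, h => by omega
  | n + 3, i, j, h => by
    obtain ⟨i, rfl⟩ : ∃ i' : Fin (n + 1), i = i'.castSucc := ⟨⟨i.1, by omega⟩, rfl⟩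
    induction j using Fin.lastCases with
    | last =>
      have hi : i.1 < n := by simpa using h
      obtain ⟨i, rfl⟩ : ∃ i' : Fin n, i = i'.castSucc := ⟨⟨i.1, hi⟩, rfl⟩
      rw [braidGen_last, braidGen_castSucc, braidGen_castSucc]
      exact far_aux c (braidGen c (n + 1) i)
    | cast j =>
      have ih := braidGen_far c (n + 2) i j (by simpa using h)
      rw [braidGen_castSucc, braidGen_castSucc]
      exact ((comp_whiskerRight _ _ X).symm.trans (congrArg (· ▷ X) ih)).trans
        (comp_whiskerRight _ _ X)

theorem braidGen_braid {X : C} {c : X ⊗ X ⟶ X ⊗ X} (hc : YangBaxter c) : (n : ℕ) →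
    (i j : Fin (n - 1)) → i.1 + 1 = j.1 → braidGen c n i ≫ braidGen c n j ≫ braidGen c n i =
      braidGen c n j ≫ braidGen c n i ≫ braidGen c n j
  | 0, i, _, _ => i.elim0
  | 1, i, _, _ => i.elim0
  | 2, i, j, h => by omega
  | n + 3, i, j, h => by
    obtain ⟨i, rfl⟩ : ∃ i' : Fin (n + 1), i = i'.castSucc := ⟨⟨i.1, by omega⟩, rfl⟩
    induction j using Fin.lastCases with
    | last =>
      obtain rfl : i = Fin.last n := by ext; simpa using h
      rw [braidGen_last, braidGen_castSucc, braidGen_last]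
      exact braid_aux hc (tensorPow X n)
    | cast j =>
      have ih := braidGen_braid hc (n + 2) i j (by simpa using h)
      rw [braidGen_castSucc, braidGen_castSucc]
      have ih' := congrArg (· ▷ X) ih
      simp only [comp_whiskerRight] at ih'
      exact ih'

/-- The action `b ↦ b^c` of `B_n^+` on `X^{⊗ n}` determined by `σ_i ↦ c^i`. Multiplication in `End`
is `f * g = f ∘ g`, so that `(b b')^c = b^c ∘ b'^c`. -/
def braidAction {X : C} (c : X ⊗ X ⟶ X ⊗ X) (hc : YangBaxter c) (n : ℕ) :
    PositiveBraidMonoid n →* End (tensorPow X n) :=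
  PresentedMonoid.lift (fun i => End.of (braidGen c n i)) (by
    rintro _ _ (⟨i, j, h⟩ | ⟨i, j, h⟩)
    · simp only [map_mul, FreeMonoid.lift_eval_of]
      exact (braidGen_far c n i j h).symm
    · simp only [map_mul, FreeMonoid.lift_eval_of]
      exact braidGen_braid hc n i j h)

/-! ### Braided systems and braided modules -/

variable (C) in
/-- A braided system of rank `r` in a monoidal category. -/
structure BraidedSystem (r : ℕ) where
  /-- The components `V_1, …, V_r`. -/
  V : Fin r → C
  /-- The braiding components `σ_{i,j} : V_i ⊗ V_j ⟶ V_j ⊗ V_i`, for `i ≤ j` only. -/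
  σ : ∀ i j : Fin r, i ≤ j → (V i ⊗ V j ⟶ V j ⊗ V i)
  /-- The colored Yang-Baxter equation. -/
  ybe : ∀ (i j k : Fin r) (hij : i ≤ j) (hjk : j ≤ k),
    σ i j hij ▷ V k ≫ (α_ (V j) (V i) (V k)).hom ≫ V j ◁ σ i k (hij.trans hjk) ≫
        (α_ (V j) (V k) (V i)).inv ≫ σ j k hjk ▷ V i =
      (α_ (V i) (V j) (V k)).hom ≫ V i ◁ σ j k hjk ≫ (α_ (V i) (V k) (V j)).inv ≫
        σ i k (hij.trans hjk) ▷ V j ≫ (α_ (V k) (V i) (V j)).hom ≫ V k ◁ σ i j hij ≫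
          (α_ (V k) (V j) (V i)).inv

/-- A right braided module structure on the object `M`. -/
structure RightBraidedModule {r : ℕ} (S : BraidedSystem C r) (M : C) where
  /-- The actions `ρ_i : M ⊗ V_i ⟶ M`. -/
  ρ : ∀ i : Fin r, M ⊗ S.V i ⟶ M
  compat : ∀ (i j : Fin r) (h : i ≤ j),
    ρ i ▷ S.V j ≫ ρ j =
      (α_ M (S.V i) (S.V j)).hom ≫ M ◁ S.σ i j h ≫ (α_ M (S.V j) (S.V i)).inv ≫
        ρ j ▷ S.V i ≫ ρ i

/-- A left braided module structure on the object `N`. -/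
structure LeftBraidedModule {r : ℕ} (S : BraidedSystem C r) (N : C) where
  /-- The actions `lam_i : V_i ⊗ N ⟶ N`. -/
  lam : ∀ i : Fin r, S.V i ⊗ N ⟶ N
  compat : ∀ (i j : Fin r) (h : i ≤ j),
    S.V i ◁ lam j ≫ lam i =
      (α_ (S.V i) (S.V j) N).inv ≫ S.σ i j h ▷ N ≫ (α_ (S.V j) (S.V i) N).hom ≫
        S.V j ◁ lam i ≫ lam j

/-! ### Additive monoidal categories -/

variable [Preadditive C] [MonoidalPreadditive C]

/-- The braided system `(V, -σ)`. -/
def BraidedSystem.neg {r : ℕ} (S : BraidedSystem C r) : BraidedSystem C r where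
  V := S.V
  σ i j h := -S.σ i j h
  ybe i j k hij hjk := by
    have wl : ∀ {X Y Z : C} (f : Y ⟶ Z), X ◁ (-f) = -(X ◁ f) := fun _ =>
      (tensorLeft _).map_neg
    have wr : ∀ {X Y Z : C} (f : Y ⟶ Z), (-f) ▷ X = -(f ▷ X) := fun _ =>
      (tensorRight _).map_neg
    simp only [wl, wr, Preadditive.neg_comp, Preadditive.comp_neg, neg_neg, S.ybe i j k hij hjk]

variable [HasFiniteBiproducts C]

/-- The tensor product `V_{w_1} ⊗ ⋯ ⊗ V_{w_n}`. -/
def wordTensor {r : ℕ} (V : Fin r → C) : (n : ℕ) → (Fin n → Fin r) → C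
  | 0, _ => 𝟙_ C
  | n + 1, w => wordTensor V n (fun i => w i.castSucc) ⊗ V (w (Fin.last n))

/-- The inclusion of the summand `V_{w_1} ⊗ ⋯ ⊗ V_{w_n}` into `(V_1 ⊕ ⋯ ⊕ V_r)^{⊗ n}`. -/
def wordι {r : ℕ} (V : Fin r → C) :
    (n : ℕ) → (w : Fin n → Fin r) → (wordTensor V n w ⟶ tensorPow (⨁ V) n)
  | 0, _ => 𝟙 _
  | n + 1, w => wordι V n (fun i => w i.castSucc) ⊗ₘ biproduct.ι V (w (Fin.last n))

/-- The projection of `(V_1 ⊕ ⋯ ⊕ V_r)^{⊗ n}` onto the summand `V_{w_1} ⊗ ⋯ ⊗ V_{w_n}`. -/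
def wordπ {r : ℕ} (V : Fin r → C) :
    (n : ℕ) → (w : Fin n → Fin r) → (tensorPow (⨁ V) n ⟶ wordTensor V n w)
  | 0, _ => 𝟙 _
  | n + 1, w => wordπ V n (fun i => w i.castSucc) ⊗ₘ biproduct.π V (w (Fin.last n))

/-- `T(V)_n^→`: the direct sum of all ordered tensor products `V_{k_1} ⊗ ⋯ ⊗ V_{k_n}` of degree `n`,
i.e. those with `k_1 ≤ ⋯ ≤ k_n`. -/
def orderedTensor {r : ℕ} (V : Fin r → C) (n : ℕ) : C :=
  ⨁ fun w : {w : Fin n → Fin r // Monotone w} => wordTensor V n w.1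

/-- The inclusion of `T(V)_n^→` into `(V_1 ⊕ ⋯ ⊕ V_r)^{⊗ n}`. -/
def orderedIncl {r : ℕ} (V : Fin r → C) (n : ℕ) : orderedTensor V n ⟶ tensorPow (⨁ V) n :=
  biproduct.desc fun w => wordι V n w.1

/-- The projection of `(V_1 ⊕ ⋯ ⊕ V_r)^{⊗ n}` onto `T(V)_n^→`. -/
def orderedProj {r : ℕ} (V : Fin r → C) (n : ℕ) : tensorPow (⨁ V) n ⟶ orderedTensor V n :=
  biproduct.lift fun w => wordπ V n w.1

/-- The partial braiding `σ` on `V_1 ⊕ ⋯ ⊕ V_r`, extended by zero to the summands `V_i ⊗ V_j` with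
`i > j`, where it is not defined. -/
def BraidedSystem.totalBraiding {r : ℕ} (S : BraidedSystem C r) :
    (⨁ S.V) ⊗ (⨁ S.V) ⟶ (⨁ S.V) ⊗ (⨁ S.V) :=
  ∑ i : Fin r, ∑ j : Fin r,
    if h : i ≤ j then
      (biproduct.π S.V i ⊗ₘ biproduct.π S.V j) ≫ S.σ i j h ≫
        (biproduct.ι S.V j ⊗ₘ biproduct.ι S.V i)
    else 0

theorem BraidedSystem.ι_totalBraiding {r : ℕ} (S : BraidedSystem C r) (i j : Fin r) :
    (biproduct.ι S.V i ⊗ₘ biproduct.ι S.V j) ≫ S.totalBraiding =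
      if h : i ≤ j then S.σ i j h ≫ (biproduct.ι S.V j ⊗ₘ biproduct.ι S.V i) else 0 := by
  rw [totalBraiding, Preadditive.comp_sum, Finset.sum_eq_single i]
  · rw [Preadditive.comp_sum, Finset.sum_eq_single j]
    · split_ifs with h
      · simp [tensorHom_comp_tensorHom_assoc]
      · simp
    · intro j' _ hj
      split_ifs with h
      · simp [tensorHom_comp_tensorHom_assoc, biproduct.ι_π_ne S.V hj.symm]
      · simp
    · simp
  · intro i' _ hi
    rw [Preadditive.comp_sum]
    refine Finset.sum_eq_zero fun j' _ => ?_
    split_ifs with h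
    · simp [tensorHom_comp_tensorHom_assoc, biproduct.ι_π_ne S.V hi.symm]
    · simp
  · simp

theorem BraidedSystem.ι_totalBraiding_whiskerRight {r : ℕ} (S : BraidedSystem C r)
    (i j k : Fin r) {Z : C} (g : ((⨁ S.V) ⊗ (⨁ S.V)) ⊗ (⨁ S.V) ⟶ Z) :
    ((biproduct.ι S.V i ⊗ₘ biproduct.ι S.V j) ⊗ₘ biproduct.ι S.V k) ≫
        S.totalBraiding ▷ (⨁ S.V) ≫ g =
      if h : i ≤ j then S.σ i j h ▷ S.V k ≫
        ((biproduct.ι S.V j ⊗ₘ biproduct.ι S.V i) ⊗ₘ biproduct.ι S.V k) ≫ g else 0 := by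
  rw [← tensorHom_id, tensorHom_comp_tensorHom_assoc, S.ι_totalBraiding]
  split_ifs with h
  · rw [← tensorHom_id, tensorHom_comp_tensorHom_assoc]
    simp
  · simp

theorem BraidedSystem.ι_totalBraiding_whiskerLeft {r : ℕ} (S : BraidedSystem C r)
    (i j k : Fin r) {Z : C} (g : (⨁ S.V) ⊗ (⨁ S.V) ⊗ (⨁ S.V) ⟶ Z) :
    (biproduct.ι S.V i ⊗ₘ biproduct.ι S.V j ⊗ₘ biproduct.ι S.V k) ≫
        (⨁ S.V) ◁ S.totalBraiding ≫ g =
      if h : j ≤ k then S.V i ◁ S.σ j k h ≫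
        (biproduct.ι S.V i ⊗ₘ biproduct.ι S.V k ⊗ₘ biproduct.ι S.V j) ≫ g else 0 := by
  rw [← id_tensorHom, tensorHom_comp_tensorHom_assoc, S.ι_totalBraiding]
  split_ifs with h
  · rw [← id_tensorHom, tensorHom_comp_tensorHom_assoc]
    simp
  · simp

/-- Extending the braiding by zero preserves the Yang-Baxter equation: unless `i ≤ j ≤ k`, both
sides vanish on `V_i ⊗ V_j ⊗ V_k`. -/
theorem BraidedSystem.yangBaxter_totalBraiding {r : ℕ} (S : BraidedSystem C r) :
    YangBaxter S.totalBraiding := by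
  have ext3 : ∀ {Z : C} (f g : ((⨁ S.V) ⊗ (⨁ S.V)) ⊗ (⨁ S.V) ⟶ Z),
      (∀ i j k, ((biproduct.ι S.V i ⊗ₘ biproduct.ι S.V j) ⊗ₘ biproduct.ι S.V k) ≫ f =
        ((biproduct.ι S.V i ⊗ₘ biproduct.ι S.V j) ⊗ₘ biproduct.ι S.V k) ≫ g) → f = g := by
    intro Z f g H
    have e : 𝟙 (((⨁ S.V) ⊗ (⨁ S.V)) ⊗ (⨁ S.V)) = ∑ k, ∑ j, ∑ i,
        ((biproduct.π S.V i ⊗ₘ biproduct.π S.V j) ⊗ₘ biproduct.π S.V k) ≫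
          ((biproduct.ι S.V i ⊗ₘ biproduct.ι S.V j) ⊗ₘ biproduct.ι S.V k) := by
      simp only [tensorHom_comp_tensorHom]
      rw [← id_tensorHom_id, ← id_tensorHom_id, ← biproduct.total]
      simp only [tensor_sum, sum_tensor]
    rw [← Category.id_comp f, ← Category.id_comp g, e]
    simp only [Preadditive.sum_comp, Category.assoc, H]
  apply ext3
  intro i j k
  have e₁ : ∀ {Z : C} (a b c : Fin r) (g : (⨁ S.V) ⊗ (⨁ S.V) ⊗ (⨁ S.V) ⟶ Z),
    ((biproduct.ι S.V a ⊗ₘ biproduct.ι S.V b) ⊗ₘ biproduct.ι S.V c) ≫ (α_ _ _ _).hom ≫ g =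
      (α_ _ _ _).hom ≫ (biproduct.ι S.V a ⊗ₘ biproduct.ι S.V b ⊗ₘ biproduct.ι S.V c) ≫ g := by
    intros
    rw [associator_naturality_assoc]
  have e₂ : ∀ {Z : C} (a b c : Fin r) (g : ((⨁ S.V) ⊗ (⨁ S.V)) ⊗ (⨁ S.V) ⟶ Z),
    (biproduct.ι S.V a ⊗ₘ biproduct.ι S.V b ⊗ₘ biproduct.ι S.V c) ≫ (α_ _ _ _).inv ≫ g =
      (α_ _ _ _).inv ≫ ((biproduct.ι S.V a ⊗ₘ biproduct.ι S.V b) ⊗ₘ biproduct.ι S.V c) ≫ g := by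
    intros
    rw [associator_inv_naturality_assoc]
  rw [← Category.comp_id (_ ▷ _ ≫ _), ← Category.comp_id ((α_ _ _ _).hom ≫ _ ≫ _)]
  simp only [Category.assoc, S.ι_totalBraiding_whiskerRight, e₁, S.ι_totalBraiding_whiskerLeft, e₂,
    comp_dite, comp_zero]
  by_cases hij : i ≤ j
  · by_cases hjk : j ≤ k
    · have h := S.ybe i j k hij hjk
      simp only [hij, hjk, hij.trans hjk, dif_pos]
      have h' := h =≫ ((biproduct.ι S.V k ⊗ₘ biproduct.ι S.V j) ⊗ₘ biproduct.ι S.V i)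
      simp only [Category.assoc] at h'
      simpa using h'
    · simp [hjk]
  · simp [hij]

/-- The partial action `b ↦ b^σ` of `B_n^+` on `(V_1 ⊕ ⋯ ⊕ V_r)^{⊗ n}`, extended by zero to the
summands on which it is not defined. -/
def BraidedSystem.action {r : ℕ} (S : BraidedSystem C r) (n : ℕ) :
    PositiveBraidMonoid n →* End (tensorPow (⨁ S.V) n) :=
  braidAction S.totalBraiding S.yangBaxter_totalBraiding n

/-- The multi-quantum coshuffle comultiplication
`∑_{θ ∈ Sh_{p,q}} (B_{θ⁻¹})^σ : T(V)_n^→ ⟶ T(V)_p^→ ⊗ T(V)_q^→`, where `n = p + q`.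

On an ordered tensor product, `(B_{θ⁻¹})^σ` only applies components `σ_{i,j}` with `i ≤ j` and takes
values in `T(V)_p^→ ⊗ T(V)_q^→`, so nothing is lost in the final projection. -/
def BraidedSystem.coshuffle {r : ℕ} (S : BraidedSystem C r) (p q : ℕ) {n : ℕ} (h : p + q = n) :
    orderedTensor S.V n ⟶ orderedTensor S.V p ⊗ orderedTensor S.V q :=
  ∑ θ ∈ shuffles p n,
    orderedIncl S.V n ≫ (S.action n (matsumoto θ⁻¹)).asHom ≫ (tensorPowSplit (⨁ S.V) p q h).hom ≫
      (orderedProj S.V p ⊗ₘ orderedProj S.V q)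

/-- The identification of `T(V)_1^→` with `V_1 ⊕ ⋯ ⊕ V_r`. -/
def degreeOne {r : ℕ} (V : Fin r → C) : orderedTensor V 1 ⟶ ⨁ V :=
  orderedIncl V 1 ≫ (λ_ (⨁ V)).hom

/-- The right action `ρ : M ⊗ (V_1 ⊕ ⋯ ⊕ V_r) ⟶ M`. -/
def RightBraidedModule.act {r : ℕ} {S : BraidedSystem C r} {M : C} (m : RightBraidedModule S M) :
    M ⊗ (⨁ S.V) ⟶ M :=
  ∑ i : Fin r, M ◁ biproduct.π S.V i ≫ m.ρ i

/-- The left action `(V_1 ⊕ ⋯ ⊕ V_r) ⊗ N ⟶ N`. -/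
def LeftBraidedModule.act {r : ℕ} {S : BraidedSystem C r} {N : C} (m : LeftBraidedModule S N) :
    (⨁ S.V) ⊗ N ⟶ N :=
  ∑ i : Fin r, biproduct.π S.V i ▷ N ≫ m.lam i

/-! ### Differentials -/

/-- The object `M ⊗ T(V)_n^→ ⊗ N`. -/
abbrev coeffTensor {r : ℕ} (V : Fin r → C) (M N : C) (n : ℕ) : C :=
  (M ⊗ orderedTensor V n) ⊗ N

/-- A differential with coefficients in `M` and `N`; the morphism of degree `n + 1` is `d n`. -/
def IsDifferential {r : ℕ} (S : BraidedSystem C r) (M N : C)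
    (d : ∀ n : ℕ, coeffTensor S.V M N (n + 1) ⟶ coeffTensor S.V M N n) : Prop :=
  ∀ n : ℕ, d (n + 1) ≫ d n = 0

/-- A bidifferential with coefficients in `M` and `N`. -/
def IsBidifferential {r : ℕ} (S : BraidedSystem C r) (M N : C)
    (d d' : ∀ n : ℕ, coeffTensor S.V M N (n + 1) ⟶ coeffTensor S.V M N n) : Prop :=
  ∀ n : ℕ, d (n + 1) ≫ d n = 0 ∧ d' (n + 1) ≫ d' n = 0 ∧
    d (n + 1) ≫ d' n + d' (n + 1) ≫ d n = 0

/-- The morphism `(^ρ d)_{n+1}`: the coshuffle comultiplication for `-σ`, followed by `ρ`. -/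
def leftDifferential {r : ℕ} {S : BraidedSystem C r} {M : C} (m : RightBraidedModule S M) (N : C)
    (n : ℕ) : coeffTensor S.V M N (n + 1) ⟶ coeffTensor S.V M N n :=
  (M ◁ S.neg.coshuffle 1 n (Nat.add_comm 1 n)) ▷ N ≫
    ((α_ M (orderedTensor S.V 1) (orderedTensor S.V n)).inv ≫
      (M ◁ degreeOne S.V ≫ m.act) ▷ orderedTensor S.V n) ▷ N

/-- The morphism `(d^λ)_{n+1}`: the coshuffle comultiplication for `-σ`, followed by `λ`, with the
sign `(-1)^n`. -/
def rightDifferential {r : ℕ} {S : BraidedSystem C r} (M : C) {N : C} (l : LeftBraidedModule S N)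
    (n : ℕ) : coeffTensor S.V M N (n + 1) ⟶ coeffTensor S.V M N n :=
  ((-1 : ℤ) ^ n) •
    ((M ◁ S.neg.coshuffle n 1 rfl) ▷ N ≫
      (α_ M (orderedTensor S.V n) (orderedTensor S.V 1)).inv ▷ N ≫
        (α_ (M ⊗ orderedTensor S.V n) (orderedTensor S.V 1) N).hom ≫
          (M ⊗ orderedTensor S.V n) ◁ (degreeOne S.V ▷ N ≫ l.act))

end MultiBraided

end

-- Extending the partial braiding by zero gives a Yang–Baxter operator on `⨁ V`, so the computation
-- can be done on full tensor powers, where the whole braid monoid acts. Two facts allow this. The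
-- projection built into `coshuffle` loses nothing (`BraidedSystem.coshuffle_orderedIncl`): a braid
-- permutes colours exactly as its permutation does, and the permutations involved preserve order
-- inside each block. Moreover the inclusion of ordered tensors is a split monomorphism
-- (`BraidedSystem.coeff_ext`).
--
-- Count factors and generators from 0. A shuffle with a block of size one is fixed by where the
-- lone element goes, and its inverse is a cycle with a unique shortest word. Hence the
-- `ρ`-differential is the sum over `k` of: pull factor `k` to the front by `s_0 ⋯ s_{k-1}`, then
-- let `M` absorb it. The `λ`-differential is the mirror image.
--
-- In the square of the first, let `T k l` pull factor `k` to the front, absorb it, and do the same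
-- to factor `l` of what remains. For `k ≤ l`, the term `T (l+1) k` extracts the same two factors in
-- the other order. By the braid relations (`IsBraidSeq.prefixProd_mul_prefixProd`) it differs from
-- `T k l` only by one extra `s_0` just before the two actions. The module axiom, read for `-σ`,
-- says that this crossing costs a factor `-1`, so the terms cancel in pairs. The axiom is available
-- only for ordered colours, which is enough: the two factors come from positions `k < l + 1` of a
-- monotone word.
--
-- For the mixed relation, extracting one factor at the front and another at the back gives the same
-- braid in either order (`IsBraidSeq.sum_reverse_mul`), and the actions on `M` and `N` do not
-- interact. The two unsigned families therefore commute, and the sign `(-1)^n` makes them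
-- anticommute.

attribute [reducible] MultiBraided.tensorPow MultiBraided.wordTensor MultiBraided.orderedTensor

set_option linter.unusedSectionVars false

noncomputable section

namespace MultiBraided

universe v u

section

/-! ### Braid sequences in a monoid -/

section Monoid

variable {G : Type*} [Monoid G]

/-- The product `s 0 * s 1 * ⋯ * s (k - 1)`. -/
def prefixProd (s : ℕ → G) (k : ℕ) : G := ((List.range k).map s).prod

@[simp] theorem prefixProd_zero (s : ℕ → G) : prefixProd s 0 = 1 := rfl

theorem prefixProd_succ (s : ℕ → G) (k : ℕ) : prefixProd s (k + 1) = prefixProd s k * s k := by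
  simp [prefixProd, List.range_succ]

theorem prefixProd_succ' (s : ℕ → G) (k : ℕ) :
    prefixProd s (k + 1) = s 0 * prefixProd (fun i => s (i + 1)) k := by
  simp only [prefixProd, List.range_succ_eq_map, List.map_cons, List.prod_cons, List.map_map]
  rfl

theorem map_prefixProd {H : Type*} [Monoid H] (φ : G →* H) (s : ℕ → G) (k : ℕ) :
    φ (prefixProd s k) = prefixProd (fun i => φ (s i)) k := by
  simp [prefixProd, map_list_prod, Function.comp_def]

theorem commute_prefixProd {s : ℕ → G} {x : G} {k : ℕ} (h : ∀ i < k, Commute x (s i)) :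
    Commute x (prefixProd s k) := by
  induction k with
  | zero => exact Commute.one_right x
  | succ k ih =>
    rw [prefixProd_succ]
    exact (ih fun i hi => h i (hi.trans k.lt_succ_self)).mul_right (h k k.lt_succ_self)

/-- The elements `s 0, …, s m` satisfy the braid relations. -/
structure IsBraidSeq (s : ℕ → G) (m : ℕ) : Prop where
  far : ∀ i j, i + 1 < j → j ≤ m → Commute (s i) (s j)
  braid : ∀ i, i + 1 ≤ m → s i * s (i + 1) * s i = s (i + 1) * s i * s (i + 1)

theorem IsBraidSeq.reverse {s : ℕ → G} {m : ℕ} (h : IsBraidSeq s m) :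
    IsBraidSeq (fun i => s (m - i)) m where
  far i j hij hj := (h.far (m - j) (m - i) (by omega) (by omega)).symm
  braid i hi := by
    have h' := h.braid (m - (i + 1)) (by omega)
    rw [show m - (i + 1) + 1 = m - i by omega] at h'
    exact h'.symm

/-- Moving a generator past the long cycle `s 0 ⋯ s l` lowers its index by one. The braid relation
is used once, in the base case; all other letters are far away and commute. -/
theorem IsBraidSeq.mul_prefixProd {s : ℕ → G} {m : ℕ} (h : IsBraidSeq s m) {j l : ℕ}
    (hj : j + 1 ≤ l) (hl : l ≤ m) : s (j + 1) * prefixProd s (l + 1) = prefixProd s (l + 1) * s j := by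
  induction l, hj using Nat.le_induction with
  | base =>
    have hc : Commute (s (j + 1)) (prefixProd s j) :=
      commute_prefixProd fun i hi => (h.far i (j + 1) (by omega) hl).symm
    rw [prefixProd_succ, prefixProd_succ, mul_assoc, ← mul_assoc (s (j + 1)), hc.eq]
    simp only [mul_assoc]
    congr 1
    simpa only [mul_assoc] using (h.braid j hl).symm
  | succ l hj ih =>
    rw [prefixProd_succ, ← mul_assoc, ih (by omega), mul_assoc, mul_assoc,
      (h.far j (l + 1) (by omega) hl).eq]

/-- This compares the two orders of extracting two factors at the front: once the leading `s 0` of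
`prefixProd s (l + 1)` is split off, the sides are the braids of `T k l`, followed by `s 0`, and of
`T (l+1) k`. -/
theorem IsBraidSeq.prefixProd_mul_prefixProd {s : ℕ → G} {m : ℕ} (h : IsBraidSeq s m) {k l : ℕ}
    (hk : k ≤ l) (hl : l ≤ m) : prefixProd s (l + 1) * prefixProd s k =
      prefixProd (fun i => s (i + 1)) k * prefixProd s (l + 1) := by
  induction k with
  | zero => simp
  | succ k ih =>
    rw [prefixProd_succ _ k, prefixProd_succ _ k, ← mul_assoc, ih (by omega), mul_assoc, mul_assoc,
      h.mul_prefixProd hk hl]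

theorem IsBraidSeq.commute_reverse {s : ℕ → G} {m : ℕ} (h : IsBraidSeq s m) {j k : ℕ}
    (hjk : j + k ≤ m) :
    Commute (prefixProd (fun i => s (m - i)) j) (prefixProd s k) := by
  refine commute_prefixProd fun b hb => (commute_prefixProd fun a ha => ?_).symm
  exact h.far b (m - a) (by omega) (by omega)

/-- The case where the strand going to the front starts to the right of the strand going to the
back, so that the two must cross. The crossing is counted in the front move on one side and in the
back move on the other. -/
theorem IsBraidSeq.reverse_mul {s : ℕ → G} {m : ℕ} (h : IsBraidSeq s m) {j k : ℕ}
    (hjk : m ≤ j + k) (hj : j ≤ m) (hk : k ≤ m) :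
    prefixProd (fun i => s (m - i)) j * prefixProd s (k + 1) =
      prefixProd s k * prefixProd (fun i => s (m - i)) (j + 1) := by
  -- At `j = m - k` the two words are still far apart except for the single letter `s k`. Each
  -- further letter is pushed through the cycle with its index lowered by one.
  obtain ⟨d, rfl⟩ : ∃ d, j = m - k + d := ⟨j - (m - k), by omega⟩
  induction d with
  | zero =>
    rw [prefixProd_succ, ← mul_assoc, (h.commute_reverse (by omega)).eq, mul_assoc,
      prefixProd_succ]
    congr 4
    omega
  | succ d ih =>
    rw [← add_assoc, prefixProd_succ (fun i => s (m - i)) (m - k + d), mul_assoc]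
    obtain ⟨i, hi⟩ : ∃ i, m - (m - k + d) = i + 1 := ⟨m - (m - k + d) - 1, by omega⟩
    rw [hi, h.mul_prefixProd (by omega) hk, ← mul_assoc, ih (by omega) (by omega),
      prefixProd_succ _ (m - k + d + 1), mul_assoc]
    congr 4
    omega

/-- Terms with `k + j ≤ m` have disjoint supports and match themselves. The others match after the
crossing is transferred, which sends `(k, j)` to `(k - 1, j + 1)`. -/
theorem IsBraidSeq.sum_reverse_mul {s : ℕ → G} {m : ℕ} (h : IsBraidSeq s m) {A : Type*}
    [AddCommMonoid A] (f : G → A) :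
    ∑ k ∈ Finset.range (m + 2), ∑ j ∈ Finset.range (m + 1),
        f (prefixProd (fun i => s (m - i)) j * prefixProd s k) =
      ∑ k ∈ Finset.range (m + 1), ∑ j ∈ Finset.range (m + 2),
        f (prefixProd s k * prefixProd (fun i => s (m - i)) j) := by
  rw [← Finset.sum_product', ← Finset.sum_product']
  refine Finset.sum_nbij' (fun x => if x.1 + x.2 ≤ m then x else (x.1 - 1, x.2 + 1))
    (fun x => if x.1 + x.2 ≤ m then x else (x.1 + 1, x.2 - 1)) ?_ ?_ ?_ ?_ ?_
  · rintro ⟨k, j⟩ hx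
    simp only [Finset.mem_product, Finset.mem_range] at hx ⊢
    split_ifs <;> simp only <;> omega
  · rintro ⟨k, j⟩ hx
    simp only [Finset.mem_product, Finset.mem_range] at hx ⊢
    split_ifs <;> simp only <;> omega
  · rintro ⟨k, j⟩ hx
    simp only [Finset.mem_product, Finset.mem_range] at hx
    by_cases h1 : k + j ≤ m
    · simp [h1]
    · have h2 : ¬ (k - 1 + (j + 1) ≤ m) := by omega
      simp only [h1, h2, if_false, Prod.mk.injEq]
      omega
  · rintro ⟨k, j⟩ hx
    simp only [Finset.mem_product, Finset.mem_range] at hx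
    by_cases h1 : k + j ≤ m
    · simp [h1]
    · have h2 : ¬ (k + 1 + (j - 1) ≤ m) := by omega
      simp only [h1, h2, if_false, Prod.mk.injEq]
      omega
  · rintro ⟨k, j⟩ hx
    simp only [Finset.mem_product, Finset.mem_range] at hx
    by_cases h1 : k + j ≤ m
    · simp only [h1, if_true]
      rw [(h.commute_reverse (by omega)).eq]
    · obtain ⟨k, rfl⟩ : ∃ k', k = k' + 1 := ⟨k - 1, by omega⟩
      simp only [h1, if_false, Nat.add_sub_cancel]
      rw [h.reverse_mul (by omega) (by omega) (by omega)]

end Monoid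

/-- The map `(k, l) ↦ (l + 1, k)` exchanges the part `k ≤ l` of the rectangle with the part `k > l`,
so it defines an involution without fixed points. -/
theorem sum_range_eq_zero_of_pairing {A : Type*} [AddCommGroup A] (n : ℕ) (T : ℕ → ℕ → A)
    (h : ∀ k l, k ≤ l → l ≤ n → T k l + T (l + 1) k = 0) :
    ∑ k ∈ Finset.range (n + 2), ∑ l ∈ Finset.range (n + 1), T k l = 0 := by
  rw [← Finset.sum_product']
  refine Finset.sum_involution
    (fun x _ => if x.1 ≤ x.2 then (x.2 + 1, x.1) else (x.2, x.1 - 1)) ?_ ?_ ?_ ?_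
  · rintro ⟨k, l⟩ hx
    simp only [Finset.mem_product, Finset.mem_range] at hx ⊢
    split_ifs with hkl
    · exact h k l hkl (by omega)
    · obtain ⟨k, rfl⟩ : ∃ k', k = k' + 1 := ⟨k - 1, by omega⟩
      rw [add_comm]
      exact h l k (by omega) (by omega)
  · rintro ⟨k, l⟩ hx _
    simp only
    split_ifs <;> simp only [ne_eq, Prod.mk.injEq] <;> omega
  · rintro ⟨k, l⟩ hx
    simp only [Finset.mem_product, Finset.mem_range] at hx ⊢
    split_ifs <;> simp only <;> omega
  · rintro ⟨k, l⟩ hx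
    simp only
    by_cases h1 : k ≤ l
    · have h2 : ¬ (l + 1 ≤ k) := by omega
      simp [h1, h2]
    · have h2 : l ≤ k - 1 := by omega
      simp only [h1, h2, if_true, if_false, Prod.mk.injEq, and_true]
      omega

/-! ### Shuffles with a part of size one -/

/-- The letter `s_i` as a word, for `i < n - 1`. -/
def letter (n i : ℕ) : FreeMonoid (Fin (n - 1)) :=
  -- The value 1 outside the range lets words be indexed by `ℕ`, as `prefixProd` requires; the
  -- braids used below contain only letters in range.
  if h : i < n - 1 then FreeMonoid.of ⟨i, h⟩ else 1

theorem letter_of_lt {n i : ℕ} (h : i < n - 1) : letter n i = FreeMonoid.of ⟨i, h⟩ := dif_pos h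

theorem wordPerm_of {n : ℕ} (i : Fin (n - 1)) :
    wordPerm n (FreeMonoid.of i) = simpleTransposition n i := FreeMonoid.lift_eval_of _ _

theorem simpleTransposition_val {n : ℕ} (i : Fin (n - 1)) (a : Fin n) :
    (simpleTransposition n i a).1 =
      if a.1 = i.1 then i.1 + 1 else if a.1 = i.1 + 1 then i.1 else a.1 := by
  unfold simpleTransposition
  rw [Equiv.swap_apply_def]
  simp only [Fin.ext_iff]
  split_ifs <;> rfl

theorem length_prefixProd_letter_le {n : ℕ} (e : ℕ → ℕ) (k : ℕ) :
    (prefixProd (fun i => letter n (e i)) k).length ≤ k := by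
  induction k with
  | zero => exact le_rfl
  | succ k ih =>
    rw [prefixProd_succ, FreeMonoid.length_mul]
    have : (letter n (e k)).length ≤ 1 := by
      unfold letter
      split_ifs <;> simp
    omega

/-- A function `φ` on `{0, …, n-1}` which decreases by at most one under each letter, and only
under the letter `t (φ a)` when it takes the value `φ a` afterwards. -/
def IsPotential {n : ℕ} (φ : Fin n → ℕ) (t : ℕ → FreeMonoid (Fin (n - 1))) : Prop :=
  ∀ i a, φ a ≤ φ (simpleTransposition n i a) ∨
    (φ a = φ (simpleTransposition n i a) + 1 ∧
      FreeMonoid.of i = t (φ (simpleTransposition n i a)))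

theorem IsPotential.le_add_length {n : ℕ} {φ : Fin n → ℕ} {t : ℕ → FreeMonoid (Fin (n - 1))}
    (h : IsPotential φ t) (l : FreeMonoid (Fin (n - 1))) (a : Fin n) :
    φ a ≤ φ (wordPerm n l a) + l.length := by
  induction l using FreeMonoid.inductionOn' generalizing a with
  | one => simp
  | of_mul i l ih =>
    rw [map_mul, wordPerm_of, Equiv.Perm.mul_apply, FreeMonoid.length_mul, FreeMonoid.length_of]
    have h1 := ih a
    have h2 := h i (wordPerm n l a)
    omega

/-- A word bringing the potential down to zero in as few letters as possible is unique. -/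
theorem IsPotential.eq_prefixProd {n : ℕ} {φ : Fin n → ℕ} {t : ℕ → FreeMonoid (Fin (n - 1))}
    (h : IsPotential φ t) (L : List (Fin (n - 1))) (a : Fin n)
    (h0 : φ (wordPerm n (FreeMonoid.ofList L) a) = 0) (hl : L.length ≤ φ a) :
    FreeMonoid.ofList L = prefixProd t (φ a) := by
  -- The last letter of a word acts first. With no letter to spare, each one must lower the
  -- potential, and the potential then dictates which letter it is.
  induction L using List.reverseRecOn generalizing a with
  | nil =>
    have : φ a = 0 := by simpa using h0
    rw [this]
    rfl
  | append_singleton L i ih =>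
    rw [FreeMonoid.ofList_append, FreeMonoid.ofList_singleton, map_mul, wordPerm_of,
      Equiv.Perm.mul_apply] at h0
    rw [List.length_append, List.length_singleton] at hl
    have h1 := h.le_add_length (FreeMonoid.ofList L) (simpleTransposition n i a)
    have h2 : (FreeMonoid.ofList L).length = L.length := rfl
    rcases h i a with h3 | ⟨h3, h4⟩
    · omega
    · rw [FreeMonoid.ofList_append, FreeMonoid.ofList_singleton, h3, prefixProd_succ,
        ih _ h0 (by omega), h4]

/-- This identifies the chosen shortest word itself, not merely its class in the braid monoid, so
Matsumoto's theorem is not needed for these cycles. -/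
theorem IsPotential.shortestWord_eq {n : ℕ} {φ : Fin n → ℕ} {e : ℕ → ℕ}
    (h : IsPotential φ fun i => letter n (e i)) {θ : Equiv.Perm (Fin n)} {a : Fin n}
    (hθ : wordPerm n (prefixProd (fun i => letter n (e i)) (φ a)) = θ) (h0 : φ (θ a) = 0) :
    shortestWord θ = prefixProd (fun i => letter n (e i)) (φ a) := by
  obtain ⟨h1, h2⟩ := (exists_shortestWord θ).choose_spec
  refine h.eq_prefixProd (FreeMonoid.toList (shortestWord θ)) a ?_
    ((h2 _ hθ).trans (length_prefixProd_letter_le _ _))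
  rw [FreeMonoid.ofList_toList]
  unfold shortestWord
  rw [h1, h0]

theorem isPotential_val (n : ℕ) : IsPotential (fun a : Fin n => a.1) (letter n) := by
  intro i a
  simp only [simpleTransposition_val]
  split_ifs with h1 h2
  · omega
  · exact Or.inr ⟨h2, (letter_of_lt i.2).symm⟩
  · omega

theorem isPotential_rev (m : ℕ) :
    IsPotential (fun a : Fin (m + 1) => m - a.1) (fun i => letter (m + 1) (m - 1 - i)) := by
  intro i a
  have hi : i.1 < m := i.2
  simp only [simpleTransposition_val]
  split_ifs with h1 h2
  · refine Or.inr ⟨by omega, ?_⟩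
    rw [letter_of_lt (by omega)]
    congr 1
    ext
    simp only
    omega
  · omega
  · omega

theorem wordPerm_prefixProd_letter {m k : ℕ} (hk : k ≤ m) (a : Fin (m + 1)) :
    (wordPerm (m + 1) (prefixProd (letter (m + 1)) k) a).1 =
      if a.1 < k then a.1 + 1 else if a.1 = k then 0 else a.1 := by
  induction k generalizing a with
  | zero =>
    simp only [prefixProd_zero, map_one, Equiv.Perm.one_apply]
    split_ifs <;> omega
  | succ k ih =>
    rw [prefixProd_succ, map_mul, letter_of_lt (by omega), wordPerm_of, Equiv.Perm.mul_apply,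
      ih (by omega), simpleTransposition_val]
    simp only
    split_ifs <;> omega

theorem wordPerm_prefixProd_letter_rev {m k : ℕ} (hk : k ≤ m) (a : Fin (m + 1)) :
    (wordPerm (m + 1) (prefixProd (fun i => letter (m + 1) (m - 1 - i)) k) a).1 =
      if a.1 < m - k then a.1 else if a.1 = m - k then m else a.1 - 1 := by
  induction k generalizing a with
  | zero =>
    have := a.2
    simp only [prefixProd_zero, map_one, Equiv.Perm.one_apply]
    split_ifs <;> omega
  | succ k ih =>
    have := a.2
    rw [prefixProd_succ, map_mul, letter_of_lt (by omega), wordPerm_of, Equiv.Perm.mul_apply,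
      ih (by omega), simpleTransposition_val]
    simp only
    split_ifs <;> omega

theorem strictMonoOn_symm_of_lt {n : ℕ} (P : Equiv.Perm (Fin n)) (S : Set (Fin n))
    (h : ∀ a b, P a ∈ S → P b ∈ S → P a < P b → a < b) : StrictMonoOn (P⁻¹ : Equiv.Perm (Fin n)) S := by
  intro x hx y hy hxy
  refine h _ _ ?_ ?_ ?_ <;> simpa

/-- The remaining values enumerate the complement of `θ 0` in increasing order, which leaves no
choice. -/
theorem eq_of_mem_shuffles_one {m : ℕ} {θ θ' : Equiv.Perm (Fin (m + 1))}
    (h : θ ∈ shuffles 1 (m + 1)) (h' : θ' ∈ shuffles 1 (m + 1)) (h0 : θ 0 = θ' 0) : θ = θ' := by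
  have key : ∀ η : Equiv.Perm (Fin (m + 1)), η ∈ shuffles 1 (m + 1) →
      StrictMono (fun i : Fin m => η i.succ) ∧ Set.range (fun i : Fin m => η i.succ) = {η 0}ᶜ := by
    intro η hη
    have hη' := (Finset.mem_filter.1 hη).2.2
    refine ⟨fun i j hij => hη' (by simp) (by simp) (by simpa), ?_⟩
    have : (fun i : Fin m => η i.succ) = η ∘ Fin.succ := rfl
    rw [this, Set.range_comp, Fin.range_succ, Set.image_compl_eq η.bijective,
      Set.image_singleton]
  obtain ⟨m1, r1⟩ := key θ h
  obtain ⟨m2, r2⟩ := key θ' h'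
  have := (m1.range_inj m2).1 (by rw [r1, r2, h0])
  ext i : 1
  refine Fin.cases h0 (fun j => congrFun this j) i

theorem eq_of_mem_shuffles_last {m : ℕ} {θ θ' : Equiv.Perm (Fin (m + 1))}
    (h : θ ∈ shuffles m (m + 1)) (h' : θ' ∈ shuffles m (m + 1))
    (h0 : θ (Fin.last m) = θ' (Fin.last m)) : θ = θ' := by
  have key : ∀ η : Equiv.Perm (Fin (m + 1)), η ∈ shuffles m (m + 1) →
      StrictMono (fun i : Fin m => η i.castSucc) ∧
        Set.range (fun i : Fin m => η i.castSucc) = {η (Fin.last m)}ᶜ := by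
    intro η hη
    have hη' := (Finset.mem_filter.1 hη).2.1
    refine ⟨fun i j hij => hη' (by simp) (by simp) (by simpa), ?_⟩
    have : (fun i : Fin m => η i.castSucc) = η ∘ Fin.castSucc := rfl
    rw [this, Set.range_comp, ← Fin.succAbove_last, Fin.range_succAbove,
      Set.image_compl_eq η.bijective, Set.image_singleton]
  obtain ⟨m1, r1⟩ := key θ h
  obtain ⟨m2, r2⟩ := key θ' h'
  have := (m1.range_inj m2).1 (by rw [r1, r2, h0])
  ext i : 1
  refine Fin.lastCases h0 (fun j => congrFun this j) i

theorem sum_shuffles_one {A : Type*} [AddCommMonoid A] (m : ℕ)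
    (f : PositiveBraidMonoid (m + 1) → A) :
    ∑ θ ∈ shuffles 1 (m + 1), f (matsumoto θ⁻¹) =
      ∑ k ∈ Finset.range (m + 1),
        f (PresentedMonoid.mk (BraidRel (m + 1)) (prefixProd (letter (m + 1)) k)) := by
  set P : ℕ → Equiv.Perm (Fin (m + 1)) := fun k =>
    wordPerm (m + 1) (prefixProd (letter (m + 1)) k) with hP
  have hval : ∀ k ≤ m, ∀ a, (P k a).1 = if a.1 < k then a.1 + 1 else if a.1 = k then 0 else a.1 :=
    fun k hk a => wordPerm_prefixProd_letter hk a
  have hmem : ∀ k ≤ m, (P k)⁻¹ ∈ shuffles 1 (m + 1) := by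
    intro k hk
    refine Finset.mem_filter.2 ⟨Finset.mem_univ _, strictMonoOn_symm_of_lt _ _ ?_,
      strictMonoOn_symm_of_lt _ _ ?_⟩ <;>
    · intro a b
      simp only [Set.mem_ofPred_eq, Fin.lt_def, hval k hk]
      split_ifs <;> omega
  have hP0 : ∀ k (hk : k ≤ m), (P k)⁻¹ 0 = ⟨k, by omega⟩ := by
    intro k hk
    rw [Equiv.Perm.inv_eq_iff_eq]
    ext
    simp [hval k hk]
  symm
  refine Finset.sum_bij' (fun k _ => (P k)⁻¹) (fun θ _ => (θ 0).1) ?_ ?_ ?_ ?_ ?_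
  · intro k hk
    exact hmem k (Nat.lt_succ_iff.1 (Finset.mem_range.1 hk))
  · intro θ _
    exact Finset.mem_range.2 (θ 0).2
  · intro k hk
    simp only [hP0 k (Nat.lt_succ_iff.1 (Finset.mem_range.1 hk))]
  · intro θ hθ
    have h1 : (θ 0).1 ≤ m := Nat.lt_succ_iff.1 (θ 0).2
    exact eq_of_mem_shuffles_one (hmem _ h1) hθ (hP0 _ h1)
  · intro k hk
    have hk' := Nat.lt_succ_iff.1 (Finset.mem_range.1 hk)
    rw [inv_inv, matsumoto]
    congr 2
    -- The potential is the position. The cycle `P k` takes position `k` to 0, which needs at least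
    -- `k` letters.
    refine ((isPotential_val (m + 1)).shortestWord_eq (a := ⟨k, by omega⟩) (e := id) rfl ?_).symm
    simpa using hval k hk' ⟨k, by omega⟩

theorem sum_shuffles_last {A : Type*} [AddCommMonoid A] (m : ℕ)
    (f : PositiveBraidMonoid (m + 1) → A) :
    ∑ θ ∈ shuffles m (m + 1), f (matsumoto θ⁻¹) =
      ∑ k ∈ Finset.range (m + 1), f (PresentedMonoid.mk (BraidRel (m + 1))
        (prefixProd (fun i => letter (m + 1) (m - 1 - i)) k)) := by
  set P : ℕ → Equiv.Perm (Fin (m + 1)) := fun k =>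
    wordPerm (m + 1) (prefixProd (fun i => letter (m + 1) (m - 1 - i)) k) with hP
  have hval : ∀ k ≤ m, ∀ a,
      (P k a).1 = if a.1 < m - k then a.1 else if a.1 = m - k then m else a.1 - 1 :=
    fun k hk a => wordPerm_prefixProd_letter_rev hk a
  have hmem : ∀ k ≤ m, (P k)⁻¹ ∈ shuffles m (m + 1) := by
    intro k hk
    refine Finset.mem_filter.2 ⟨Finset.mem_univ _, strictMonoOn_symm_of_lt _ _ ?_,
      strictMonoOn_symm_of_lt _ _ ?_⟩ <;>
    · intro a b
      have := a.2
      have := b.2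
      simp only [Set.mem_ofPred_eq, Fin.lt_def, hval k hk]
      split_ifs <;> omega
  have hP0 : ∀ k (hk : k ≤ m), (P k)⁻¹ (Fin.last m) = ⟨m - k, by omega⟩ := by
    intro k hk
    rw [Equiv.Perm.inv_eq_iff_eq]
    ext
    simp [hval k hk]
  symm
  refine Finset.sum_bij' (fun k _ => (P k)⁻¹) (fun θ _ => m - (θ (Fin.last m)).1) ?_ ?_ ?_ ?_ ?_
  · intro k hk
    exact hmem k (Nat.lt_succ_iff.1 (Finset.mem_range.1 hk))
  · intro θ _
    exact Finset.mem_range.2 (by omega)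
  · intro k hk
    have hk' := Nat.lt_succ_iff.1 (Finset.mem_range.1 hk)
    simp only [hP0 k hk']
    omega
  · intro θ hθ
    have h1 : m - (θ (Fin.last m)).1 ≤ m := Nat.sub_le _ _
    refine eq_of_mem_shuffles_last (hmem _ h1) hθ ((hP0 _ h1).trans ?_)
    have := (θ (Fin.last m)).2
    ext
    simp only
    omega
  · intro k hk
    have hk' := Nat.lt_succ_iff.1 (Finset.mem_range.1 hk)
    rw [inv_inv, matsumoto]
    congr 2
    have hφ : m - (m - k) = k := by omega
    have h := (isPotential_rev m).shortestWord_eq (θ := P k) (a := ⟨m - k, by omega⟩)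
      (e := fun i => m - 1 - i) (by simp only [hφ, hP])
      (by simp [hval k hk'])
    simp only [hφ] at h
    exact h.symm

end

section

variable {C : Type u} [Category.{v} C] [MonoidalCategory C] [Preadditive C] [MonoidalPreadditive C]
  [HasFiniteBiproducts C] {r : ℕ}

/-! ### Words and the tensor powers of `V_1 ⊕ ⋯ ⊕ V_r` -/

/-- Equal words give summands that need not be definitionally equal. The unspecified factor `g`
absorbs the transport; later lemmas use the same existential form because only vanishing is ever
deduced from them. -/
theorem exists_wordπ_of_eq (V : Fin r → C) {n : ℕ} {w w' : Fin n → Fin r} (h : w' = w) :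
    ∃ g, wordπ V n w = wordπ V n w' ≫ g := by
  subst h
  exact ⟨𝟙 _, (Category.comp_id _).symm⟩

theorem exists_π_of_eq (V : Fin r → C) {i j : Fin r} (h : j = i) :
    ∃ g, biproduct.π V i = biproduct.π V j ≫ g := by
  subst h
  exact ⟨𝟙 _, (Category.comp_id _).symm⟩

theorem wordι_wordπ_self (V : Fin r → C) (n : ℕ) (w : Fin n → Fin r) :
    wordι V n w ≫ wordπ V n w = 𝟙 _ := by
  induction n with
  | zero => exact Category.comp_id _
  | succ n ih =>
    rw [wordι, wordπ]
    refine (tensorHom_comp_tensorHom _ _ _ _).trans ?_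
    rw [ih, biproduct.ι_π_self]
    exact id_tensorHom_id _ _

theorem wordι_wordπ_ne (V : Fin r → C) (n : ℕ) {w w' : Fin n → Fin r} (h : w ≠ w') :
    wordι V n w ≫ wordπ V n w' = 0 := by
  induction n with
  | zero => exact absurd (Subsingleton.elim _ _) h
  | succ n ih =>
    rw [wordι, wordπ]
    refine (tensorHom_comp_tensorHom _ _ _ _).trans ?_
    by_cases h1 : w (Fin.last n) = w' (Fin.last n)
    · have h2 : (fun i : Fin n => w i.castSucc) ≠ fun i => w' i.castSucc := by
        intro h2
        apply h
        ext i : 1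
        exact Fin.lastCases h1 (fun j => congrFun h2 j) i
      rw [ih h2, MonoidalPreadditive.zero_tensor]
    · rw [biproduct.ι_π_ne V h1, MonoidalPreadditive.tensor_zero]

theorem sum_snoc {ι A : Type*} [Fintype ι] [DecidableEq ι] [AddCommMonoid A] {n : ℕ}
    (f : (Fin n → ι) → ι → A) :
    ∑ w : Fin (n + 1) → ι, f (fun i => w i.castSucc) (w (Fin.last n)) = ∑ i, ∑ u, f u i := by
  rw [← (Fin.snocEquiv fun _ : Fin (n + 1) => ι).sum_comp, Fintype.sum_prod_type]
  simp [Fin.snocEquiv]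

theorem sum_wordπ_wordι (V : Fin r → C) (n : ℕ) :
    ∑ w : Fin n → Fin r, wordπ V n w ≫ wordι V n w = 𝟙 (tensorPow (⨁ V) n) := by
  induction n with
  | zero =>
    rw [Fintype.sum_unique]
    exact Category.comp_id _
  | succ n ih =>
    have h : ∀ w : Fin (n + 1) → Fin r, wordπ V (n + 1) w ≫ wordι V (n + 1) w =
        (wordπ V n (fun i => w i.castSucc) ≫ wordι V n (fun i => w i.castSucc)) ⊗ₘ
          (biproduct.π V (w (Fin.last n)) ≫ biproduct.ι V (w (Fin.last n))) := fun w =>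
      tensorHom_comp_tensorHom _ _ _ _
    simp only [h]
    refine (sum_snoc fun u i => (wordπ V n u ≫ wordι V n u) ⊗ₘ
      (biproduct.π V i ≫ biproduct.ι V i)).trans ?_
    simp only [← sum_tensor, ← tensor_sum]
    rw [ih, biproduct.total]
    exact id_tensorHom_id _ _

theorem hom_ext_wordπ_tensor (V : Fin r → C) {p q : ℕ} {A : C}
    {f g : A ⟶ tensorPow (⨁ V) p ⊗ tensorPow (⨁ V) q}
    (h : ∀ u v, f ≫ (wordπ V p u ⊗ₘ wordπ V q v) = g ≫ (wordπ V p u ⊗ₘ wordπ V q v)) : f = g := by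
  have e : 𝟙 (tensorPow (⨁ V) p ⊗ tensorPow (⨁ V) q) = ∑ v, ∑ u,
      (wordπ V p u ⊗ₘ wordπ V q v) ≫ (wordι V p u ⊗ₘ wordι V q v) := by
    simp only [tensorHom_comp_tensorHom, ← sum_tensor, ← tensor_sum, sum_wordπ_wordι,
      id_tensorHom_id]
  rw [← Category.comp_id f, ← Category.comp_id g, e]
  simp only [Preadditive.comp_sum, reassoc_of% h]

theorem exists_tensorPowAdd_wordπ (V : Fin r → C) (p q : ℕ) (w : Fin (p + q) → Fin r) :
    ∃ g, (tensorPowAdd (⨁ V) p q).hom ≫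
      (wordπ V p (w ∘ Fin.castAdd q) ⊗ₘ wordπ V q (w ∘ Fin.natAdd p)) =
        wordπ V (p + q) w ≫ g := by
  induction q with
  | zero =>
    refine ⟨(ρ_ _).inv, ?_⟩
    change (ρ_ _).inv ≫ (_ ⊗ₘ 𝟙 _) = _
    rw [tensorHom_id]
    exact (rightUnitor_inv_naturality (wordπ V p w)).symm
  | succ q ih =>
    obtain ⟨g, hg⟩ := ih fun i => w i.castSucc
    refine ⟨g ▷ _ ≫ (α_ _ _ _).hom, ?_⟩
    change ((tensorPowAdd (⨁ V) p q).hom ▷ _ ≫ (α_ _ _ _).hom) ≫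
      (_ ⊗ₘ (_ ⊗ₘ biproduct.π V (w (Fin.last (p + q))))) = (_ ⊗ₘ _) ≫ _
    rw [Category.assoc, ← associator_naturality, ← tensorHom_id, ← tensorHom_id,
      tensorHom_comp_tensorHom_assoc, tensorHom_comp_tensorHom_assoc, Category.id_comp,
      Category.comp_id]
    congr 2

/-! ### Ordered tensors -/

theorem orderedIncl_wordπ (V : Fin r → C) (n : ℕ) (w : {w : Fin n → Fin r // Monotone w}) :
    orderedIncl V n ≫ wordπ V n w.1 = biproduct.π _ w := by
  refine biproduct.hom_ext' _ _ fun u => ?_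
  rw [orderedIncl, biproduct.ι_desc_assoc]
  by_cases h : u = w
  · subst h
    rw [wordι_wordπ_self, biproduct.ι_π_self]
  · rw [wordι_wordπ_ne V n (fun h' => h (Subtype.ext h')), biproduct.ι_π_ne _ h]

theorem orderedIncl_wordπ_eq_zero (V : Fin r → C) (n : ℕ) {w : Fin n → Fin r} (h : ¬ Monotone w) :
    orderedIncl V n ≫ wordπ V n w = 0 := by
  refine biproduct.hom_ext' _ _ fun u => ?_
  rw [orderedIncl, biproduct.ι_desc_assoc, comp_zero]
  exact wordι_wordπ_ne V n fun h' => h (h' ▸ u.2)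

theorem orderedIncl_orderedProj (V : Fin r → C) (n : ℕ) :
    orderedIncl V n ≫ orderedProj V n = 𝟙 _ := by
  refine biproduct.hom_ext _ _ fun w => ?_
  rw [orderedProj, Category.assoc, biproduct.lift_π, orderedIncl_wordπ, Category.id_comp]

theorem orderedProj_orderedIncl_wordπ (V : Fin r → C) (n : ℕ) {w : Fin n → Fin r}
    (h : Monotone w) : orderedProj V n ≫ orderedIncl V n ≫ wordπ V n w = wordπ V n w := by
  rw [orderedIncl_wordπ V n ⟨w, h⟩, orderedProj, biproduct.lift_π]

/-! ### The action of words -/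

theorem BraidedSystem.exists_totalBraiding_π (S : BraidedSystem C r) (i j : Fin r) :
    ∃ g, S.totalBraiding ≫ (biproduct.π S.V i ⊗ₘ biproduct.π S.V j) =
      (biproduct.π S.V j ⊗ₘ biproduct.π S.V i) ≫ g := by
  refine ⟨if h : j ≤ i then S.σ j i h else 0, ?_⟩
  rw [totalBraiding, Preadditive.sum_comp, Finset.sum_eq_single j]
  · rw [Preadditive.sum_comp, Finset.sum_eq_single i]
    · split_ifs with h
      · simp [tensorHom_comp_tensorHom]
      · simp
    · intro i' _ hi
      split_ifs with h
      · simp [tensorHom_comp_tensorHom, biproduct.ι_π_ne S.V hi]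
      · simp
    · simp
  · intro j' _ hj
    rw [Preadditive.sum_comp]
    refine Finset.sum_eq_zero fun i' _ => ?_
    split_ifs with h
    · simp [tensorHom_comp_tensorHom, biproduct.ι_π_ne S.V hj]
    · simp
  · simp

/-- A generator exchanges two adjacent colours, so the output of colour `w` sees only the input of
colour `w ∘ s_i`. Inputs on which the braiding is undefined contribute zero, which also fits this
form. -/
theorem BraidedSystem.exists_braidGen_wordπ (S : BraidedSystem C r) : (n : ℕ) → (i : Fin (n - 1)) →
    (w : Fin n → Fin r) → ∃ g, braidGen S.totalBraiding n i ≫ wordπ S.V n w =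
      wordπ S.V n (w ∘ simpleTransposition n i) ≫ g
  | 0, i, _ => i.elim0
  | 1, i, _ => i.elim0
  | n + 2, i, w => by
    set w' := w ∘ simpleTransposition (n + 2) i with hw'
    have hval := simpleTransposition_val (n := n + 2) i
    induction i using Fin.lastCases with
    | last =>
      have e1 : (fun j : Fin n => w' j.castSucc.castSucc) = fun j => w j.castSucc.castSucc := by
        ext j : 1
        refine congrArg w (Fin.ext ?_)
        have := j.2
        rw [hval]
        simp only [Fin.val_castSucc, Fin.val_last]
        split_ifs <;> omega
      have e2 : w' (Fin.last n).castSucc = w (Fin.last (n + 1)) := by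
        refine congrArg w (Fin.ext ?_)
        rw [hval]
        simp
      have e3 : w' (Fin.last (n + 1)) = w (Fin.last n).castSucc := by
        refine congrArg w (Fin.ext ?_)
        rw [hval]
        simp
      obtain ⟨g1, h1⟩ := exists_wordπ_of_eq S.V e1
      obtain ⟨g2, h2⟩ := exists_π_of_eq S.V e2
      obtain ⟨g3, h3⟩ := exists_π_of_eq S.V e3
      obtain ⟨g, hg⟩ := S.exists_totalBraiding_π (w (Fin.last n).castSucc) (w (Fin.last (n + 1)))
      refine ⟨(α_ _ _ _).hom ≫ (g1 ⊗ₘ ((g2 ⊗ₘ g3) ≫ g)) ≫ (α_ _ _ _).inv, ?_⟩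
      rw [braidGen_last]
      change ((α_ _ _ _).hom ≫ _ ◁ _ ≫ (α_ _ _ _).inv) ≫ ((wordπ S.V n (fun j => w j.castSucc.castSucc)
        ⊗ₘ biproduct.π S.V (w (Fin.last n).castSucc)) ⊗ₘ biproduct.π S.V (w (Fin.last (n + 1)))) =
        ((wordπ S.V n (fun j => w' j.castSucc.castSucc)
        ⊗ₘ biproduct.π S.V (w' (Fin.last n).castSucc)) ⊗ₘ biproduct.π S.V (w' (Fin.last (n + 1)))) ≫ _
      rw [associator_naturality_assoc, tensorHom_comp_tensorHom_assoc,
        tensorHom_comp_tensorHom_assoc, ← h1, ← h2, ← h3, ← hg, Category.assoc, Category.assoc,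
        ← associator_inv_naturality, ← id_tensorHom, tensorHom_comp_tensorHom_assoc,
        Category.id_comp]
    | cast i =>
      have e1 : (fun j : Fin (n + 1) => w' j.castSucc) =
          (fun j => w j.castSucc) ∘ simpleTransposition (n + 1) i := by
        ext j : 1
        refine congrArg w (Fin.ext ?_)
        rw [hval]
        simp only [Fin.val_castSucc]
        rw [simpleTransposition_val]
      have e2 : w' (Fin.last (n + 1)) = w (Fin.last (n + 1)) := by
        refine congrArg w (Fin.ext ?_)
        have := i.2
        rw [hval]
        simp only [Fin.val_castSucc, Fin.val_last]
        split_ifs <;> omega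
      obtain ⟨g1, h1⟩ := S.exists_braidGen_wordπ (n + 1) i fun j => w j.castSucc
      obtain ⟨g2, h2⟩ := exists_π_of_eq S.V e2
      obtain ⟨g3, h3⟩ := exists_wordπ_of_eq S.V e1
      refine ⟨(g3 ≫ g1) ⊗ₘ g2, ?_⟩
      rw [braidGen_castSucc]
      change _ ▷ _ ≫ (wordπ S.V (n + 1) (fun j => w j.castSucc) ⊗ₘ
        biproduct.π S.V (w (Fin.last (n + 1)))) = (wordπ S.V (n + 1) (fun j => w' j.castSucc) ⊗ₘ
        biproduct.π S.V (w' (Fin.last (n + 1)))) ≫ _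
      rw [tensorHom_comp_tensorHom, ← h2, ← Category.assoc, ← h3, ← h1, ← tensorHom_id]
      exact (tensorHom_comp_tensorHom _ _ _ _).trans (by rw [Category.id_comp])

/-- The action of words in the generators of the positive braid monoid. -/
def BraidedSystem.wordAction (S : BraidedSystem C r) (n : ℕ) :
    FreeMonoid (Fin (n - 1)) →* End (tensorPow (⨁ S.V) n) :=
  (S.action n).comp (PresentedMonoid.mk (BraidRel n))

theorem BraidedSystem.wordAction_of (S : BraidedSystem C r) (n : ℕ) (i : Fin (n - 1)) :
    S.wordAction n (FreeMonoid.of i) = braidGen S.totalBraiding n i := rfl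

theorem BraidedSystem.exists_wordAction_wordπ (S : BraidedSystem C r) (n : ℕ)
    (l : FreeMonoid (Fin (n - 1))) (w : Fin n → Fin r) :
    ∃ g, (S.wordAction n l).asHom ≫ wordπ S.V n w = wordπ S.V n (w ∘ wordPerm n l) ≫ g := by
  induction l using FreeMonoid.inductionOn' generalizing w with
  | one =>
    refine ⟨𝟙 _, ?_⟩
    change S.wordAction n 1 ≫ _ = _
    rw [map_one, End.one_def]
    exact (Category.id_comp _).trans (Category.comp_id _).symm
  | of_mul i l ih =>
    obtain ⟨g, hg⟩ := S.exists_braidGen_wordπ n i w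
    obtain ⟨g', hg'⟩ := ih (w ∘ simpleTransposition n i)
    have e : w ∘ wordPerm n (FreeMonoid.of i * l) =
        (w ∘ simpleTransposition n i) ∘ wordPerm n l := by
      rw [map_mul, wordPerm_of]
      rfl
    rw [e]
    refine ⟨g' ≫ g, ?_⟩
    rw [map_mul, End.mul_def, wordAction_of]
    simp only [Category.assoc, hg]
    exact (reassoc_of% hg') g

theorem BraidedSystem.orderedIncl_wordAction_wordπ (S : BraidedSystem C r) {n : ℕ}
    (l : FreeMonoid (Fin (n - 1))) {w : Fin n → Fin r} (h : ¬ Monotone (w ∘ wordPerm n l)) :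
    orderedIncl S.V n ≫ (S.wordAction n l).asHom ≫ wordπ S.V n w = 0 := by
  obtain ⟨g, hg⟩ := S.exists_wordAction_wordπ n l w
  rw [hg, ← Category.assoc, orderedIncl_wordπ_eq_zero S.V n h, zero_comp]

theorem wordPerm_shortestWord {n : ℕ} (θ : Equiv.Perm (Fin n)) :
    wordPerm n (shortestWord θ) = θ := (exists_shortestWord θ).choose_spec.1

/-- The coshuffle comultiplication takes values in tensors of ordered tensors. -/
theorem BraidedSystem.shuffle_orderedProj_orderedIncl (S : BraidedSystem C r) (p q : ℕ) {n : ℕ}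
    (h : p + q = n) {θ : Equiv.Perm (Fin n)} (hθ : θ ∈ shuffles p n) :
    orderedIncl S.V n ≫ (S.action n (matsumoto θ⁻¹)).asHom ≫ (tensorPowSplit (⨁ S.V) p q h).hom ≫
      (orderedProj S.V p ⊗ₘ orderedProj S.V q) ≫ (orderedIncl S.V p ⊗ₘ orderedIncl S.V q) =
    orderedIncl S.V n ≫ (S.action n (matsumoto θ⁻¹)).asHom ≫
      (tensorPowSplit (⨁ S.V) p q h).hom := by
  subst h
  obtain ⟨hp, hq⟩ := (Finset.mem_filter.1 hθ).2
  have hs : (tensorPowSplit (⨁ S.V) p q rfl).hom = (tensorPowAdd (⨁ S.V) p q).hom :=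
    Category.id_comp _
  rw [hs]
  refine hom_ext_wordπ_tensor S.V fun u v => ?_
  by_cases huv : Monotone u ∧ Monotone v
  · simp only [Category.assoc, tensorHom_comp_tensorHom, orderedProj_orderedIncl_wordπ S.V p huv.1,
      orderedProj_orderedIncl_wordπ S.V q huv.2]
  · have e : (orderedProj S.V p ⊗ₘ orderedProj S.V q) ≫ (orderedIncl S.V p ⊗ₘ orderedIncl S.V q) ≫
        (wordπ S.V p u ⊗ₘ wordπ S.V q v) = 0 := by
      simp only [tensorHom_comp_tensorHom]
      by_cases hu : Monotone u
      · rw [orderedIncl_wordπ_eq_zero S.V q (fun hv => huv ⟨hu, hv⟩), comp_zero, MonoidalPreadditive.tensor_zero]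
      · rw [orderedIncl_wordπ_eq_zero S.V p hu, comp_zero, MonoidalPreadditive.zero_tensor]
    simp only [Category.assoc, e, comp_zero]
    obtain ⟨w, rfl, rfl⟩ : ∃ w : Fin (p + q) → Fin r,
        u = w ∘ Fin.castAdd q ∧ v = w ∘ Fin.natAdd p :=
      ⟨Fin.append u v, by ext; simp, by ext; simp⟩
    obtain ⟨g, hg⟩ := exists_tensorPowAdd_wordπ S.V p q w
    rw [hg]
    -- Since `θ` is increasing on each block, composing a monotone `w ∘ θ⁻¹` with it would make both
    -- `u` and `v` monotone.
    have hw : ¬ Monotone (w ∘ wordPerm (p + q) (shortestWord θ⁻¹)) := by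
      rw [wordPerm_shortestWord]
      intro hm
      refine huv ⟨fun a b hab => ?_, fun a b hab => ?_⟩
      · simpa using hm (hp.monotoneOn (by simp) (by simp)
          (show Fin.castAdd q a ≤ Fin.castAdd q b by simpa))
      · simpa using hm (hq.monotoneOn (by simp) (by simp)
          (show Fin.natAdd p a ≤ Fin.natAdd p b by simpa))
    have := S.orderedIncl_wordAction_wordπ (shortestWord θ⁻¹) hw
    have := this =≫ g
    simp only [Category.assoc, zero_comp] at this
    exact this.symm

theorem BraidedSystem.coshuffle_orderedIncl (S : BraidedSystem C r) (p q : ℕ) {n : ℕ}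
    (h : p + q = n) :
    S.coshuffle p q h ≫ (orderedIncl S.V p ⊗ₘ orderedIncl S.V q) =
      ∑ θ ∈ shuffles p n, orderedIncl S.V n ≫ (S.action n (matsumoto θ⁻¹)).asHom ≫
        (tensorPowSplit (⨁ S.V) p q h).hom := by
  rw [coshuffle, Preadditive.sum_comp]
  refine Finset.sum_congr rfl fun θ hθ => ?_
  simp only [Category.assoc]
  exact S.shuffle_orderedProj_orderedIncl p q h hθ

end

section

/-! ### Actions on the outer factors of a tensor power -/

section Actions

variable {C : Type u} [Category.{v} C] [MonoidalCategory C] {X M N : C}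

theorem braidGen_eq_last (c : X ⊗ X ⟶ X ⊗ X) {n i : ℕ} (h : i < n + 2 - 1) (hi : i = n) :
    braidGen c (n + 2) ⟨i, h⟩ =
      (α_ (tensorPow X n) X X).hom ≫ tensorPow X n ◁ c ≫ (α_ (tensorPow X n) X X).inv := by
  subst hi
  exact braidGen_last c i

theorem braidGen_eq_whiskerRight (c : X ⊗ X ⟶ X ⊗ X) {n i : ℕ} (h : i < n + 2 - 1) (hi : i < n) :
    braidGen c (n + 2) ⟨i, h⟩ = braidGen c (n + 1) ⟨i, hi⟩ ▷ X :=
  braidGen_castSucc c n ⟨i, hi⟩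

/-- The action of the first factor of `X^{⊗ (n+1)}` on `M`. -/
def headAct (a : M ⊗ X ⟶ M) : (n : ℕ) → (M ⊗ tensorPow X (n + 1) ⟶ M ⊗ tensorPow X n)
  | 0 => M ◁ (λ_ X).hom ≫ a ≫ (ρ_ M).inv
  | n + 1 => (α_ M (tensorPow X (n + 1)) X).inv ≫ headAct a n ▷ X ≫ (α_ M (tensorPow X n) X).hom

/-- The action of the last factor of `X^{⊗ (n+1)}` on `N`. -/
def tailAct (b : X ⊗ N ⟶ N) (n : ℕ) : tensorPow X (n + 1) ⊗ N ⟶ tensorPow X n ⊗ N :=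
  (α_ (tensorPow X n) X N).hom ≫ tensorPow X n ◁ b

theorem headAct_succ (a : M ⊗ X ⟶ M) (n : ℕ) : headAct a (n + 1) =
    (α_ M (tensorPow X (n + 1)) X).inv ≫ headAct a n ▷ X ≫ (α_ M (tensorPow X n) X).hom := rfl

theorem head_far_aux {Y Z : C} (f : M ⊗ Y ⟶ M ⊗ Z) (c : X ⊗ X ⟶ X ⊗ X) :
    M ◁ ((α_ Y X X).hom ≫ Y ◁ c ≫ (α_ Y X X).inv) ≫ (α_ M (Y ⊗ X) X).inv ≫
        ((α_ M Y X).inv ≫ f ▷ X ≫ (α_ M Z X).hom) ▷ X ≫ (α_ M (Z ⊗ X) X).hom =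
      ((α_ M (Y ⊗ X) X).inv ≫
        ((α_ M Y X).inv ≫ f ▷ X ≫ (α_ M Z X).hom) ▷ X ≫ (α_ M (Z ⊗ X) X).hom) ≫
          M ◁ ((α_ Z X X).hom ≫ Z ◁ c ≫ (α_ Z X X).inv) := by
  have e : ∀ (Y : C), M ◁ ((α_ Y X X).hom ≫ Y ◁ c ≫ (α_ Y X X).inv) =
      M ◁ (α_ Y X X).hom ≫ (α_ M Y (X ⊗ X)).inv ≫ (M ⊗ Y) ◁ c ≫ (α_ M Y (X ⊗ X)).hom ≫
        M ◁ (α_ Y X X).inv := by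
    intro Y
    monoidal
  have e' : (α_ M (Y ⊗ X) X).inv ≫
        ((α_ M Y X).inv ≫ f ▷ X ≫ (α_ M Z X).hom) ▷ X ≫ (α_ M (Z ⊗ X) X).hom =
      M ◁ (α_ Y X X).hom ≫ (α_ M Y (X ⊗ X)).inv ≫ f ▷ (X ⊗ X) ≫ (α_ M Z (X ⊗ X)).hom ≫
        M ◁ (α_ Z X X).inv := by
    monoidal
  rw [e, e, e']
  simp only [Category.assoc, whiskerLeft_inv_hom_assoc, Iso.hom_inv_id_assoc,
    whisker_exchange_assoc]

/-- A crossing away from the first factor may be done before or after that factor is absorbed;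
afterwards its index is one lower. -/
theorem braidGen_headAct (a : M ⊗ X ⟶ M) (c : X ⊗ X ⟶ X ⊗ X) : (n i : ℕ) → (h : i < n - 1) →
    M ◁ braidGen c (n + 1) ⟨i + 1, by omega⟩ ≫ headAct a n =
      headAct a n ≫ M ◁ braidGen c n ⟨i, h⟩
  | 0, i, h => absurd h (by omega)
  | 1, i, h => absurd h (by omega)
  | n + 2, i, h => by
    rcases Nat.lt_or_ge i n with hi | hi
    · have ih := braidGen_headAct a c (n + 1) i hi
      rw [braidGen_eq_whiskerRight c _ hi, braidGen_eq_whiskerRight c _ (Nat.succ_lt_succ hi),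
        headAct_succ a (n + 1), associator_inv_naturality_middle_assoc, ← comp_whiskerRight_assoc,
        ih, comp_whiskerRight_assoc, associator_naturality_middle]
      simp only [Category.assoc]
    · have hi' : i = n := by omega
      rw [braidGen_eq_last c _ hi', braidGen_eq_last c _ (congrArg (· + 1) hi')]
      exact head_far_aux (headAct a n) c

theorem braidGen_tailAct (b : X ⊗ N ⟶ N) (c : X ⊗ X ⟶ X ⊗ X) : (n i : ℕ) → (h : i < n - 1) →
    braidGen c (n + 1) ⟨i, by omega⟩ ▷ N ≫ tailAct b n =
      tailAct b n ≫ braidGen c n ⟨i, h⟩ ▷ N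
  | 0, i, h => absurd h (by omega)
  | n + 1, i, h => by
    rw [braidGen_eq_whiskerRight c (n := n) _ h, tailAct, associator_naturality_left_assoc,
      ← whisker_exchange, Category.assoc]

theorem tail_head_aux {Y Z : C} (f : M ⊗ Y ⟶ M ⊗ Z) (b : X ⊗ N ⟶ N) :
    ((α_ M Y X).inv ≫ f ▷ X ≫ (α_ M Z X).hom) ▷ N ≫
        (α_ M (Z ⊗ X) N).hom ≫ M ◁ ((α_ Z X N).hom ≫ Z ◁ b) ≫ (α_ M Z N).inv =
      ((α_ M (Y ⊗ X) N).hom ≫ M ◁ ((α_ Y X N).hom ≫ Y ◁ b) ≫ (α_ M Y N).inv) ≫ f ▷ N := by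
  have e : ∀ (Y : C), (α_ M (Y ⊗ X) N).hom ≫ M ◁ ((α_ Y X N).hom ≫ Y ◁ b) ≫ (α_ M Y N).inv =
      (α_ M Y X).inv ▷ N ≫ (α_ (M ⊗ Y) X N).hom ≫ (M ⊗ Y) ◁ b := by
    intro Y
    monoidal
  rw [e, e]
  simp only [Category.assoc, whisker_exchange]
  rw [comp_whiskerRight_assoc, comp_whiskerRight_assoc, hom_inv_whiskerRight_assoc,
    associator_naturality_left_assoc]

theorem headAct_tailAct (a : M ⊗ X ⟶ M) (b : X ⊗ N ⟶ N) (n : ℕ) :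
    headAct a (n + 1) ▷ N ≫
        (α_ M (tensorPow X (n + 1)) N).hom ≫ M ◁ tailAct b n ≫ (α_ M (tensorPow X n) N).inv =
      ((α_ M (tensorPow X (n + 2)) N).hom ≫ M ◁ tailAct b (n + 1) ≫
        (α_ M (tensorPow X (n + 1)) N).inv) ≫ headAct a n ▷ N :=
  tail_head_aux (headAct a n) b

/-- This connects the first-factor splitting used in the differential with the recursive `headAct`,
which is suited to left-nested tensor powers. -/
theorem tensorPowSplit_head (a : M ⊗ X ⟶ M) (n : ℕ) :
    M ◁ (tensorPowSplit X 1 n (Nat.add_comm 1 n)).hom ≫ M ◁ ((λ_ X).hom ▷ tensorPow X n) ≫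
      (α_ M X (tensorPow X n)).inv ≫ a ▷ tensorPow X n = headAct a n := by
  induction n with
  | zero =>
    have e : (tensorPowSplit X 1 0 (Nat.add_comm 1 0)).hom = (ρ_ (tensorPow X 1)).inv :=
      Category.id_comp _
    rw [e]
    change M ◁ (ρ_ (𝟙_ C ⊗ X)).inv ≫ M ◁ ((λ_ X).hom ▷ 𝟙_ C) ≫ (α_ M X (𝟙_ C)).inv ≫ a ▷ 𝟙_ C =
      M ◁ (λ_ X).hom ≫ a ≫ (ρ_ M).inv
    rw [rightUnitor_inv_naturality]
    monoidal
  | succ n ih =>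
    -- The total degree is made a variable because `1 + n` is not definitionally `n + 1`;
    -- substituting it turns the transport in `tensorPowSplit` into an identity.
    have e : ∀ {m : ℕ} (h : 1 + n = m) (h' : 1 + (n + 1) = m + 1),
        (tensorPowSplit X 1 (n + 1) h').hom =
          (tensorPowSplit X 1 n h).hom ▷ X ≫ (α_ _ _ _).hom := by
      rintro m rfl h'
      simp [tensorPowSplit, tensorPowAdd]
    rw [e (Nat.add_comm 1 n), headAct_succ, ← ih]
    change M ◁ ((tensorPowSplit X 1 n (Nat.add_comm 1 n)).hom ▷ X ≫
      (α_ (𝟙_ C ⊗ X) (tensorPow X n) X).hom) ≫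
      M ◁ ((λ_ X).hom ▷ (tensorPow X n ⊗ X)) ≫ (α_ M X (tensorPow X n ⊗ X)).inv ≫
        a ▷ (tensorPow X n ⊗ X) = _
    generalize (tensorPowSplit X 1 n (Nat.add_comm 1 n)).hom = t
    change tensorPow X (n + 1) ⟶ (𝟙_ C ⊗ X) ⊗ tensorPow X n at t
    monoidal

theorem tensorPowSplit_tail (n : ℕ) :
    (tensorPowSplit X n 1 rfl).hom ≫ tensorPow X n ◁ (λ_ X).hom = 𝟙 _ := by
  have e : (tensorPowSplit X n 1 rfl).hom =
      (ρ_ (tensorPow X n)).inv ▷ X ≫ (α_ (tensorPow X n) (𝟙_ C) X).hom := Category.id_comp _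
  rw [e]
  change ((ρ_ (tensorPow X n)).inv ▷ X ≫ (α_ (tensorPow X n) (𝟙_ C) X).hom) ≫ _ =
    𝟙 (tensorPow X n ⊗ X)
  monoidal

theorem head_tensor_aux {W Y Z Z' U : C} (p : W ⟶ Y) (q : U ⟶ X) (f : M ⊗ Y ⟶ M ⊗ Z)
    (g : M ⊗ Z ⟶ M ⊗ Z') :
    M ◁ (p ⊗ₘ q) ≫ ((α_ M Y X).inv ≫ f ▷ X ≫ (α_ M Z X).hom) ≫
        (α_ M Z X).inv ≫ g ▷ X ≫ (α_ M Z' X).hom =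
      (α_ M W U).inv ≫ (M ◁ p ≫ f ≫ g) ▷ U ≫ (M ⊗ Z') ◁ q ≫ (α_ M Z' X).hom := by
  rw [← whisker_exchange_assoc, MonoidalCategory.tensorHom_def']
  monoidal

theorem head_tensor_comp_aux {W Y Z Z' U : C} (p : W ⟶ Y) (q : U ⟶ X) (t : Y ⟶ Y)
    (f : M ⊗ Y ⟶ M ⊗ Z) (g : M ⊗ Z ⟶ M ⊗ Z') :
    M ◁ (p ⊗ₘ q) ≫ M ◁ (t ▷ X) ≫ ((α_ M Y X).inv ≫ f ▷ X ≫ (α_ M Z X).hom) ≫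
        (α_ M Z X).inv ≫ g ▷ X ≫ (α_ M Z' X).hom =
      (α_ M W U).inv ≫ (M ◁ p ≫ M ◁ t ≫ f ≫ g) ▷ U ≫ (M ⊗ Z') ◁ q ≫ (α_ M Z' X).hom := by
  have h : M ◁ (p ⊗ₘ q) ≫ M ◁ (t ▷ X) = M ◁ ((p ≫ t) ⊗ₘ q) := by
    rw [← whiskerLeft_comp, ← tensorHom_id, tensorHom_comp_tensorHom, Category.comp_id]
  rw [reassoc_of% h, head_tensor_aux, whiskerLeft_comp, Category.assoc]

theorem tail_tensor_aux {W Z A B : C} (p : W ⟶ Z) (i : A ⟶ X) (j : B ⟶ X) (b : X ⊗ N ⟶ N) :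
    ((p ⊗ₘ i) ⊗ₘ j) ▷ N ≫ ((α_ (Z ⊗ X) X N).hom ≫ (Z ⊗ X) ◁ b) ≫ (α_ Z X N).hom ≫ Z ◁ b =
      (α_ W A B).hom ▷ N ≫ (α_ W (A ⊗ B) N).hom ≫
        (p ⊗ₘ ((i ⊗ₘ j) ▷ N ≫ (α_ X X N).hom ≫ X ◁ b ≫ b)) := by
  monoidal

theorem tail_tensor_comp_aux {W Z A B : C} (p : W ⟶ Z) (i : A ⟶ X) (j : B ⟶ X) (b : X ⊗ N ⟶ N)
    (c : X ⊗ X ⟶ X ⊗ X) :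
    ((p ⊗ₘ i) ⊗ₘ j) ▷ N ≫ ((α_ Z X X).hom ≫ Z ◁ c ≫ (α_ Z X X).inv) ▷ N ≫
        ((α_ (Z ⊗ X) X N).hom ≫ (Z ⊗ X) ◁ b) ≫ (α_ Z X N).hom ≫ Z ◁ b =
      (α_ W A B).hom ▷ N ≫ (α_ W (A ⊗ B) N).hom ≫
        (p ⊗ₘ ((i ⊗ₘ j) ▷ N ≫ c ▷ N ≫ (α_ X X N).hom ≫ X ◁ b ≫ b)) := by
  monoidal

end Actions

/-! ### The sign produced by a crossing before two actions -/

section Compat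

variable {C : Type u} [Category.{v} C] [MonoidalCategory C] [Preadditive C] [MonoidalPreadditive C]
  [HasFiniteBiproducts C] {r : ℕ} {V : Fin r → C} {M N : C}

theorem neg_whiskerRight {X Y : C} (f : X ⟶ Y) (Z : C) : (-f) ▷ Z = -(f ▷ Z) :=
  (tensorRight Z).map_neg

theorem whiskerLeft_neg {X Y : C} (Z : C) (f : X ⟶ Y) : Z ◁ (-f) = -(Z ◁ f) :=
  (tensorLeft Z).map_neg

theorem tensor_neg {W X Y Z : C} (f : W ⟶ X) (g : Y ⟶ Z) : f ⊗ₘ (-g) = -(f ⊗ₘ g) := by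
  rw [MonoidalCategory.tensorHom_def, whiskerLeft_neg, Preadditive.comp_neg,
    ← MonoidalCategory.tensorHom_def]

/-- Right modules up to sign over the ordered part of a braiding of `V_1 ⊕ ⋯ ⊕ V_r`. -/
def RightAntiCompat (c : (⨁ V) ⊗ (⨁ V) ⟶ (⨁ V) ⊗ (⨁ V)) (a : M ⊗ (⨁ V) ⟶ M) : Prop :=
  ∀ i j : Fin r, i ≤ j →
    M ◁ (biproduct.ι V i ⊗ₘ biproduct.ι V j) ≫ M ◁ c ≫ (α_ _ _ _).inv ≫ a ▷ _ ≫ a =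
      -(M ◁ (biproduct.ι V i ⊗ₘ biproduct.ι V j) ≫ (α_ _ _ _).inv ≫ a ▷ _ ≫ a)

/-- Left modules up to sign over the ordered part of a braiding of `V_1 ⊕ ⋯ ⊕ V_r`. -/
def LeftAntiCompat (c : (⨁ V) ⊗ (⨁ V) ⟶ (⨁ V) ⊗ (⨁ V)) (b : (⨁ V) ⊗ N ⟶ N) : Prop :=
  ∀ i j : Fin r, i ≤ j →
    (biproduct.ι V i ⊗ₘ biproduct.ι V j) ▷ N ≫ c ▷ N ≫ (α_ _ _ _).hom ≫ _ ◁ b ≫ b =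
      -((biproduct.ι V i ⊗ₘ biproduct.ι V j) ▷ N ≫ (α_ _ _ _).hom ≫ _ ◁ b ≫ b)

/-- Left nesting buries the first two factors, so the relation is carried outwards by tensoring with
one more last factor at a time. The base case is the hypothesis up to unitors. -/
theorem RightAntiCompat.braidGen {c : (⨁ V) ⊗ (⨁ V) ⟶ (⨁ V) ⊗ (⨁ V)} {a : M ⊗ (⨁ V) ⟶ M}
    (h : RightAntiCompat c a) (n : ℕ) (w : Fin (n + 2) → Fin r)
    (hw : w ⟨0, by omega⟩ ≤ w ⟨1, by omega⟩) :
    M ◁ wordι V (n + 2) w ≫ M ◁ braidGen c (n + 2) ⟨0, by omega⟩ ≫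
        headAct a (n + 1) ≫ headAct a n =
      -(M ◁ wordι V (n + 2) w ≫ headAct a (n + 1) ≫ headAct a n) := by
  induction n with
  | zero =>
    rw [braidGen_eq_last c _ rfl]
    have e : headAct a 1 ≫ headAct a 0 = M ◁ ((λ_ (⨁ V)).hom ▷ (⨁ V)) ≫
        (α_ M (⨁ V) (⨁ V)).inv ≫ a ▷ _ ≫ a ≫ (ρ_ M).inv := by
      change ((α_ M (𝟙_ C ⊗ ⨁ V) (⨁ V)).inv ≫ (M ◁ (λ_ (⨁ V)).hom ≫ a ≫ (ρ_ M).inv) ▷ (⨁ V) ≫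
        (α_ M (𝟙_ C) (⨁ V)).hom) ≫ M ◁ (λ_ (⨁ V)).hom ≫ a ≫ (ρ_ M).inv = _
      simp
    have e1 : ((α_ (𝟙_ C) (⨁ V) (⨁ V)).hom ≫ 𝟙_ C ◁ c ≫ (α_ (𝟙_ C) (⨁ V) (⨁ V)).inv) ≫
        (λ_ (⨁ V)).hom ▷ (⨁ V) = (λ_ (⨁ V)).hom ▷ (⨁ V) ≫ c := by
      monoidal
    have e2 : wordι V 2 w ≫ (λ_ (⨁ V)).hom ▷ (⨁ V) = (λ_ (V (w 0))).hom ▷ V (w 1) ≫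
        (biproduct.ι V (w 0) ⊗ₘ biproduct.ι V (w 1)) := by
      change ((𝟙 (𝟙_ C) ⊗ₘ biproduct.ι V (w 0)) ⊗ₘ biproduct.ι V (w 1)) ≫ _ = _
      monoidal
    have e3 := h (w 0) (w 1) hw =≫ (ρ_ M).inv
    simp only [Category.assoc, Preadditive.neg_comp] at e3
    rw [e]
    change M ◁ _ ≫ M ◁ ((α_ (𝟙_ C) (⨁ V) (⨁ V)).hom ≫ 𝟙_ C ◁ c ≫ (α_ (𝟙_ C) (⨁ V) (⨁ V)).inv) ≫ _ =
      _
    rw [← whiskerLeft_comp_assoc M (_ ≫ _ ≫ _), e1, whiskerLeft_comp_assoc,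
      ← whiskerLeft_comp_assoc, e2, whiskerLeft_comp_assoc, e3,
      ← whiskerLeft_comp_assoc M (wordι V 2 w), e2, whiskerLeft_comp_assoc, Preadditive.comp_neg]
  | succ n ih =>
    have ih' := ih (fun i => w i.castSucc) hw
    rw [braidGen_eq_whiskerRight c _ (Nat.succ_pos n), headAct_succ a (n + 1), headAct_succ a n]
    change M ◁ (wordι V (n + 2) (fun i => w i.castSucc) ⊗ₘ biproduct.ι V (w (Fin.last (n + 2)))) ≫ _ =
      -(M ◁ (wordι V (n + 2) (fun i => w i.castSucc) ⊗ₘ biproduct.ι V (w (Fin.last (n + 2)))) ≫ _)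
    have key := congrArg (fun f => (α_ M _ _).inv ≫ f ▷ V (w (Fin.last (n + 2))) ≫
      _ ◁ biproduct.ι V (w (Fin.last (n + 2))) ≫ (α_ M _ _).hom) ih'
    simp only [neg_whiskerRight, Preadditive.neg_comp, Preadditive.comp_neg] at key
    refine Eq.trans ?_ (key.trans (congrArg Neg.neg ?_))
    · exact head_tensor_comp_aux _ _ _ _ _
    · exact (head_tensor_aux _ _ _ _).symm

/-- Here no induction is needed: the last two factors are outermost in the left-nested power. -/
theorem LeftAntiCompat.braidGen {c : (⨁ V) ⊗ (⨁ V) ⟶ (⨁ V) ⊗ (⨁ V)} {b : (⨁ V) ⊗ N ⟶ N}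
    (h : LeftAntiCompat c b) (n : ℕ) (w : Fin (n + 2) → Fin r)
    (hw : w (Fin.last n).castSucc ≤ w (Fin.last (n + 1))) :
    wordι V (n + 2) w ▷ N ≫ braidGen c (n + 2) ⟨n, by omega⟩ ▷ N ≫
        tailAct b (n + 1) ≫ tailAct b n =
      -(wordι V (n + 2) w ▷ N ≫ tailAct b (n + 1) ≫ tailAct b n) := by
  rw [braidGen_eq_last c _ rfl]
  have e := h _ _ hw
  have e' := congrArg (fun f => (α_ (wordTensor V n fun i => w i.castSucc.castSucc) _ _).hom ▷ N ≫
    (α_ _ _ _).hom ≫ (wordι V n (fun i => w i.castSucc.castSucc) ⊗ₘ f)) e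
  refine (tail_tensor_comp_aux _ _ _ _ _).trans (e'.trans ?_)
  rw [tensor_neg, Preadditive.comp_neg, Preadditive.comp_neg]
  exact congrArg Neg.neg (tail_tensor_aux _ _ _ _).symm

end Compat

end

section

/-! ### Sums of braids followed by actions -/

theorem IsBraidSeq.map {G H : Type*} [Monoid G] [Monoid H] (φ : G →* H) {s : ℕ → G} {m : ℕ}
    (h : IsBraidSeq s m) : IsBraidSeq (fun i => φ (s i)) m where
  far i j hij hj := (h.far i j hij hj).map φ
  braid i hi := by simpa only [map_mul] using congrArg φ (h.braid i hi)

section Abstract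

variable {D : Type u} [Category.{v} D]

theorem prefixProd_comp_intertwine {X Y : D} {s : ℕ → End X} {t : ℕ → End Y} {e : X ⟶ Y} {l : ℕ}
    (h : ∀ i < l, (s i).asHom ≫ e = e ≫ (t i).asHom) :
    (prefixProd s l).asHom ≫ e = e ≫ (prefixProd t l).asHom := by
  induction l with
  | zero => exact (Category.id_comp e).trans (Category.comp_id e).symm
  | succ l ih =>
    rw [prefixProd_succ, prefixProd_succ, End.mul_def, End.mul_def, Category.assoc,
      ih fun i hi => h i (hi.trans l.lt_succ_self), ← Category.assoc, h l l.lt_succ_self,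
      Category.assoc]

variable [Preadditive D]

/-- Pairing off the two ways of extracting two factors one after the other. -/
theorem IsBraidSeq.sum_sum_eq_zero {A X Y Z : D} {m : ℕ} {s : ℕ → End X} {t : ℕ → End Y}
    (hs : IsBraidSeq s m) (i : A ⟶ X) (e : X ⟶ Y) (e' : Y ⟶ Z)
    (hst : ∀ i < m, (s (i + 1)).asHom ≫ e = e ≫ (t i).asHom)
    (h : ∀ k l, k ≤ l → l ≤ m →
      i ≫ (prefixProd (fun i => s (i + 1)) l * prefixProd s k).asHom ≫ (s 0).asHom ≫ e ≫ e' =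
        -(i ≫ (prefixProd (fun i => s (i + 1)) l * prefixProd s k).asHom ≫ e ≫ e')) :
    i ≫ (∑ k ∈ Finset.range (m + 2), (prefixProd s k).asHom) ≫ e ≫
      (∑ l ∈ Finset.range (m + 1), (prefixProd t l).asHom) ≫ e' = 0 := by
  simp only [Preadditive.sum_comp, Preadditive.comp_sum]
  have hT : ∀ k l, l ≤ m → i ≫ (prefixProd s k).asHom ≫ e ≫ (prefixProd t l).asHom ≫ e' =
      i ≫ (prefixProd (fun i => s (i + 1)) l * prefixProd s k).asHom ≫ e ≫ e' := by
    intro k l hl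
    rw [← reassoc_of% (prefixProd_comp_intertwine (s := fun i => s (i + 1)) (t := t) (e := e)
      (l := l) fun i hi => hst i (hi.trans_le hl)), End.mul_def, Category.assoc]
  rw [Finset.sum_comm]
  refine sum_range_eq_zero_of_pairing m (fun k l =>
    i ≫ (prefixProd s k).asHom ≫ e ≫ (prefixProd t l).asHom ≫ e') fun k l hkl hl => ?_
  -- The braid of `T (l+1) k` becomes `s 0` times the braid of `T k l`, so `h` turns the former term
  -- into minus the latter.
  rw [hT k l hl, hT (l + 1) k (hkl.trans hl), ← hs.prefixProd_mul_prefixProd hkl hl,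
    prefixProd_succ', mul_assoc, End.mul_def (s 0), Category.assoc, h k l hkl hl, add_neg_cancel]

/-- Extracting a factor on the left commutes with extracting a factor on the right. -/
theorem IsBraidSeq.sum_comp_sum_comm {X Y Y' Z : D} {m : ℕ} {s : ℕ → End X} {t : ℕ → End Y}
    {t' : ℕ → End Y'} (hs : IsBraidSeq s m) (e : X ⟶ Y) (f : Y ⟶ Z) (f' : X ⟶ Y') (e' : Y' ⟶ Z)
    (hc : e ≫ f = f' ≫ e')
    (ht : ∀ i < m, (s (m - i)).asHom ≫ e = e ≫ (t i).asHom)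
    (ht' : ∀ i < m, (s i).asHom ≫ f' = f' ≫ (t' i).asHom) :
    ((∑ k ∈ Finset.range (m + 2), (prefixProd s k).asHom) ≫ e) ≫
        (∑ j ∈ Finset.range (m + 1), (prefixProd t j).asHom) ≫ f =
      ((∑ j ∈ Finset.range (m + 2), (prefixProd (fun i => s (m - i)) j).asHom) ≫ f') ≫
        (∑ k ∈ Finset.range (m + 1), (prefixProd t' k).asHom) ≫ e' := by
  have h := hs.sum_reverse_mul fun x : End X => x.asHom ≫ e ≫ f
  have h1 : ∀ k, ∀ j ∈ Finset.range (m + 1),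
      (prefixProd (fun i => s (m - i)) j * prefixProd s k).asHom ≫ e ≫ f =
        (prefixProd s k).asHom ≫ e ≫ (prefixProd t j).asHom ≫ f := by
    intro k j hj
    rw [End.mul_def, Category.assoc, reassoc_of% (prefixProd_comp_intertwine
      (s := fun i => s (m - i)) (t := t) (e := e) (l := j) fun i hi =>
        ht i (hi.trans_le (Nat.lt_succ_iff.1 (Finset.mem_range.1 hj))))]
  have h2 : ∀ j, ∀ k ∈ Finset.range (m + 1),
      (prefixProd s k * prefixProd (fun i => s (m - i)) j).asHom ≫ e ≫ f =
        (prefixProd (fun i => s (m - i)) j).asHom ≫ f' ≫ (prefixProd t' k).asHom ≫ e' := by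
    intro j k hk
    rw [hc, End.mul_def, Category.assoc, reassoc_of% (prefixProd_comp_intertwine
      (s := s) (t := t') (e := f') (l := k) fun i hi =>
        ht' i (hi.trans_le (Nat.lt_succ_iff.1 (Finset.mem_range.1 hk))))]
  simp only [Preadditive.sum_comp, Preadditive.comp_sum, Category.assoc]
  exact (Finset.sum_congr rfl fun j hj => Finset.sum_congr rfl fun k _ => (h1 k j hj).symm).trans
    ((Finset.sum_comm.trans h).trans
      (Finset.sum_congr rfl fun k hk => Finset.sum_congr rfl fun j _ => h2 j k hk))

end Abstract

/-! ### Front and back extraction on full tensor powers with coefficients -/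

variable {C : Type u} [Category.{v} C] [MonoidalCategory C]

/-- The functor `M ⊗ - ⊗ N`. -/
abbrev coeffFunctor (M N : C) : C ⥤ C where
  obj Y := (M ⊗ Y) ⊗ N
  map f := (M ◁ f) ▷ N

/-- The action of the last factor of `X^{⊗ (n+1)}` on `N`, with coefficients in `M`. -/
def coeffTailAct (M : C) {X N : C} (b : X ⊗ N ⟶ N) (n : ℕ) :
    (M ⊗ tensorPow X (n + 1)) ⊗ N ⟶ (M ⊗ tensorPow X n) ⊗ N :=
  (α_ M (tensorPow X (n + 1)) N).hom ≫ M ◁ tailAct b n ≫ (α_ M (tensorPow X n) N).inv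

variable [Preadditive C] [MonoidalPreadditive C]

instance (M N : C) : (coeffFunctor M N).Additive where
  map_add := by
    intro X Y f g
    change (M ◁ (f + g)) ▷ N = (M ◁ f) ▷ N + (M ◁ g) ▷ N
    rw [MonoidalPreadditive.whiskerLeft_add, MonoidalPreadditive.add_whiskerRight]

variable [HasFiniteBiproducts C] {r : ℕ}

/-- The sign relation is checked colour by colour: `f` is expanded over all words, and those
violating `P` do not occur in its image. -/
theorem coeffFunctor_comp_eq_neg {V : Fin r → C} {M N A Z : C} {n : ℕ}
    {f : A ⟶ tensorPow (⨁ V) n} {P : (Fin n → Fin r) → Prop}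
    (hf : ∀ w, ¬ P w → f ≫ wordπ V n w = 0)
    {g g' : (coeffFunctor M N).obj (tensorPow (⨁ V) n) ⟶ Z}
    (hg : ∀ w, P w → (coeffFunctor M N).map (wordι V n w) ≫ g =
      -((coeffFunctor M N).map (wordι V n w) ≫ g')) :
    (coeffFunctor M N).map f ≫ g = -((coeffFunctor M N).map f ≫ g') := by
  have e : (coeffFunctor M N).map f = ∑ w, (coeffFunctor M N).map (f ≫ wordπ V n w) ≫
      (coeffFunctor M N).map (wordι V n w) := by
    conv_lhs => rw [← Category.comp_id f, ← sum_wordπ_wordι, Preadditive.comp_sum,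
      Functor.map_sum]
    refine Finset.sum_congr rfl fun w _ => ?_
    rw [← Functor.map_comp, Category.assoc]
  rw [e, Preadditive.sum_comp, Preadditive.sum_comp, ← Finset.sum_neg_distrib]
  refine Finset.sum_congr rfl fun w _ => ?_
  by_cases h : P w
  · rw [Category.assoc, Category.assoc, hg w h, Preadditive.comp_neg]
  · rw [hf w h, Functor.map_zero, zero_comp, zero_comp, zero_comp, neg_zero]

namespace BraidedSystem

variable (S : BraidedSystem C r) (M N : C)

theorem isBraidSeq_letter (m : ℕ) :
    IsBraidSeq (fun i => S.wordAction (m + 2) (letter (m + 2) i)) m where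
  far i j hij hj := by
    rw [letter_of_lt (by omega), letter_of_lt (by omega)]
    exact (braidGen_far S.totalBraiding (m + 2) ⟨i, by omega⟩ ⟨j, by omega⟩ hij).symm
  braid i hi := by
    rw [letter_of_lt (by omega), letter_of_lt (by omega)]
    exact braidGen_braid S.yangBaxter_totalBraiding (m + 2) ⟨i, by omega⟩ ⟨i + 1, by omega⟩ rfl

/-- The action of words on `M ⊗ (V_1 ⊕ ⋯ ⊕ V_r)^{⊗ n} ⊗ N`. -/
def coeffAction (n : ℕ) :
    FreeMonoid (Fin (n - 1)) →* End ((coeffFunctor M N).obj (tensorPow (⨁ S.V) n)) :=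
  ((coeffFunctor M N).mapEnd _).comp (S.wordAction n)

theorem coeffAction_letter {n i : ℕ} (h : i < n - 1) :
    (S.coeffAction M N n (letter n i)).asHom =
      (M ◁ braidGen S.totalBraiding n ⟨i, h⟩) ▷ N := by
  rw [letter_of_lt h]
  rfl

theorem coeffAction_letter_headAct (a : M ⊗ (⨁ S.V) ⟶ M) {n i : ℕ} (h : i < n - 1) :
    (S.coeffAction M N (n + 1) (letter (n + 1) (i + 1))).asHom ≫ headAct a n ▷ N =
      headAct a n ▷ N ≫ (S.coeffAction M N n (letter n i)).asHom := by
  rw [coeffAction_letter S M N h, coeffAction_letter S M N (by omega), ← comp_whiskerRight,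
    ← comp_whiskerRight, braidGen_headAct a S.totalBraiding n i h]

theorem coeffAction_letter_tailAct (b : (⨁ S.V) ⊗ N ⟶ N) {n i : ℕ} (h : i < n - 1) :
    (S.coeffAction M N (n + 1) (letter (n + 1) i)).asHom ≫ coeffTailAct M b n =
      coeffTailAct M b n ≫ (S.coeffAction M N n (letter n i)).asHom := by
  rw [coeffAction_letter S M N h, coeffAction_letter S M N (by omega), coeffTailAct,
    associator_naturality_middle_assoc, ← whiskerLeft_comp_assoc,
    braidGen_tailAct b S.totalBraiding n i h]
  simp only [whiskerLeft_comp, Category.assoc, associator_inv_naturality_middle]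

/-- The sum of the braids which bring one factor to the front. -/
def frontSum (n : ℕ) : tensorPow (⨁ S.V) (n + 1) ⟶ tensorPow (⨁ S.V) (n + 1) :=
  ∑ k ∈ Finset.range (n + 1), (S.wordAction (n + 1) (prefixProd (letter (n + 1)) k)).asHom

/-- The sum of the braids which bring one factor to the back. -/
def backSum (n : ℕ) : tensorPow (⨁ S.V) (n + 1) ⟶ tensorPow (⨁ S.V) (n + 1) :=
  ∑ k ∈ Finset.range (n + 1),
    (S.wordAction (n + 1) (prefixProd (fun i => letter (n + 1) (n - 1 - i)) k)).asHom

theorem coshuffle_one_left (n : ℕ) :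
    S.coshuffle 1 n (Nat.add_comm 1 n) ≫ (orderedIncl S.V 1 ⊗ₘ orderedIncl S.V n) =
      orderedIncl S.V (n + 1) ≫ S.frontSum n ≫
        (tensorPowSplit (⨁ S.V) 1 n (Nat.add_comm 1 n)).hom := by
  rw [coshuffle_orderedIncl, frontSum, Preadditive.sum_comp, Preadditive.comp_sum]
  exact sum_shuffles_one n fun b => orderedIncl S.V (n + 1) ≫ (S.action (n + 1) b).asHom ≫
    (tensorPowSplit (⨁ S.V) 1 n (Nat.add_comm 1 n)).hom

theorem coshuffle_one_right (n : ℕ) :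
    S.coshuffle n 1 rfl ≫ (orderedIncl S.V n ⊗ₘ orderedIncl S.V 1) =
      orderedIncl S.V (n + 1) ≫ S.backSum n ≫ (tensorPowSplit (⨁ S.V) n 1 rfl).hom := by
  rw [coshuffle_orderedIncl, backSum, Preadditive.sum_comp, Preadditive.comp_sum]
  exact sum_shuffles_last n fun b => orderedIncl S.V (n + 1) ≫ (S.action (n + 1) b).asHom ≫
    (tensorPowSplit (⨁ S.V) n 1 rfl).hom

theorem coeffFunctor_frontSum (n : ℕ) : (coeffFunctor M N).map (S.frontSum n) =
    ∑ k ∈ Finset.range (n + 1),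
      (prefixProd (fun i => S.coeffAction M N (n + 1) (letter (n + 1) i)) k).asHom := by
  rw [frontSum, Functor.map_sum]
  refine Finset.sum_congr rfl fun k _ => ?_
  exact map_prefixProd (S.coeffAction M N (n + 1)) _ k

theorem coeffFunctor_backSum (n : ℕ) : (coeffFunctor M N).map (S.backSum n) =
    ∑ k ∈ Finset.range (n + 1),
      (prefixProd (fun i => S.coeffAction M N (n + 1) (letter (n + 1) (n - 1 - i))) k).asHom := by
  rw [backSum, Functor.map_sum]
  refine Finset.sum_congr rfl fun k _ => ?_
  exact map_prefixProd (S.coeffAction M N (n + 1)) _ k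

theorem isBraidSeq_coeffAction (m : ℕ) :
    IsBraidSeq (fun i => S.coeffAction M N (m + 2) (letter (m + 2) i)) m :=
  (S.isBraidSeq_letter m).map ((coeffFunctor M N).mapEnd _)

variable {M N}

theorem front_comp_front {a : M ⊗ (⨁ S.V) ⟶ M} (ha : RightAntiCompat S.totalBraiding a) (m : ℕ) :
    (coeffFunctor M N).map (orderedIncl S.V (m + 2)) ≫
      (coeffFunctor M N).map (S.frontSum (m + 1)) ≫ headAct a (m + 1) ▷ N ≫
        (coeffFunctor M N).map (S.frontSum m) ≫ headAct a m ▷ N = 0 := by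
  rw [coeffFunctor_frontSum, coeffFunctor_frontSum]
  refine (S.isBraidSeq_coeffAction M N m).sum_sum_eq_zero _ _ _
    (fun i hi => S.coeffAction_letter_headAct M N a hi) fun k l hkl hl => ?_
  set l₀ := prefixProd (fun i => letter (m + 2) (i + 1)) l * prefixProd (letter (m + 2)) k with hl₀
  have e : prefixProd (fun i => S.coeffAction M N (m + 2) (letter (m + 2) (i + 1))) l *
      prefixProd (fun i => S.coeffAction M N (m + 2) (letter (m + 2) i)) k =
        S.coeffAction M N (m + 2) l₀ := by
    rw [hl₀, map_mul, map_prefixProd, map_prefixProd]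
  -- With `s_0` in front, `l₀` becomes a product of two known cycles; its own values are recovered
  -- by undoing this transposition.
  have hperm : wordPerm (m + 2) (letter (m + 2) 0 * l₀) =
      wordPerm (m + 2) (prefixProd (letter (m + 2)) (l + 1)) *
        wordPerm (m + 2) (prefixProd (letter (m + 2)) k) := by
    rw [hl₀, ← mul_assoc, ← prefixProd_succ', map_mul]
  rw [map_mul, letter_of_lt (by omega), wordPerm_of] at hperm
  have hval : ∀ x, (simpleTransposition (m + 2) ⟨0, by omega⟩ (wordPerm (m + 2) l₀ x)).1 = _ :=
    fun x => congrArg Fin.val (DFunLike.congr_fun hperm x)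
  -- After `l₀`, the factors originally at `k` and `l + 1` occupy positions 0 and 1. As `k < l + 1`,
  -- monotone input makes these two colours ordered.
  have hk : wordPerm (m + 2) l₀ ⟨k, by omega⟩ = ⟨0, by omega⟩ := by
    have h := hval ⟨k, by omega⟩
    rw [simpleTransposition_val, Equiv.Perm.mul_apply,
      wordPerm_prefixProd_letter (m := m + 1) (by omega),
      wordPerm_prefixProd_letter (m := m + 1) (by omega)] at h
    ext
    dsimp only [Fin.val_last, Fin.val_castSucc] at h ⊢
    split_ifs at h <;> omega
  have hl' : wordPerm (m + 2) l₀ ⟨l + 1, by omega⟩ = ⟨1, by omega⟩ := by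
    have h := hval ⟨l + 1, by omega⟩
    rw [simpleTransposition_val, Equiv.Perm.mul_apply,
      wordPerm_prefixProd_letter (m := m + 1) (by omega),
      wordPerm_prefixProd_letter (m := m + 1) (by omega)] at h
    ext
    dsimp only [Fin.val_last, Fin.val_castSucc] at h ⊢
    split_ifs at h <;> omega
  have key := coeffFunctor_comp_eq_neg (V := S.V) (M := M) (N := N)
    (f := orderedIncl S.V (m + 2) ≫ (S.wordAction (m + 2) l₀).asHom)
    (P := fun w => w ⟨0, by omega⟩ ≤ w ⟨1, by omega⟩)
    (g := (M ◁ braidGen S.totalBraiding (m + 2) ⟨0, by omega⟩) ▷ N ≫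
      headAct a (m + 1) ▷ N ≫ headAct a m ▷ N)
    (g' := headAct a (m + 1) ▷ N ≫ headAct a m ▷ N)
    (by
      intro w hw
      rw [Category.assoc]
      refine S.orderedIncl_wordAction_wordπ l₀ fun hm => hw ?_
      have := hm (show (⟨k, by omega⟩ : Fin (m + 2)) ≤ ⟨l + 1, by omega⟩ from
        Fin.le_def.2 (by simp only; omega))
      simpa only [Function.comp_apply, hk, hl'] using this)
    (by
      intro w hw
      have := congrArg (· ▷ N) (ha.braidGen m w hw)
      simp only [neg_whiskerRight, comp_whiskerRight] at this
      exact this)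
  rw [Functor.map_comp, Category.assoc, Category.assoc] at key
  rw [e, S.coeffAction_letter M N (by omega)]
  exact key

theorem back_comp_back {b : (⨁ S.V) ⊗ N ⟶ N} (hb : LeftAntiCompat S.totalBraiding b) (m : ℕ) :
    (coeffFunctor M N).map (orderedIncl S.V (m + 2)) ≫
      (coeffFunctor M N).map (S.backSum (m + 1)) ≫ coeffTailAct M b (m + 1) ≫
        (coeffFunctor M N).map (S.backSum m) ≫ coeffTailAct M b m = 0 := by
  rw [coeffFunctor_backSum, coeffFunctor_backSum]
  -- Generators are numbered from the back. Absorbing the last factor keeps the index from the front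
  -- but lowers the index from the back by one, as the pairing lemma requires.
  refine (S.isBraidSeq_coeffAction M N m).reverse.sum_sum_eq_zero _ _ _
    (fun i hi => ?_) fun k l hkl hl => ?_
  · rw [show m - (i + 1) = m - 1 - i by omega]
    exact S.coeffAction_letter_tailAct M N b (by omega)
  set l₀ := prefixProd (fun i => letter (m + 2) (m - (i + 1))) l *
    prefixProd (fun i => letter (m + 2) (m - i)) k with hl₀
  have e : prefixProd (fun i => S.coeffAction M N (m + 2) (letter (m + 2) (m - (i + 1)))) l *
      prefixProd (fun i => S.coeffAction M N (m + 2) (letter (m + 2) (m - i))) k =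
        S.coeffAction M N (m + 2) l₀ := by
    rw [hl₀, map_mul, map_prefixProd, map_prefixProd]
  have hperm : wordPerm (m + 2) (letter (m + 2) m * l₀) =
      wordPerm (m + 2) (prefixProd (fun i => letter (m + 2) (m - i)) (l + 1)) *
        wordPerm (m + 2) (prefixProd (fun i => letter (m + 2) (m - i)) k) := by
    rw [hl₀, ← mul_assoc, ← map_mul, prefixProd_succ', Nat.sub_zero]
  rw [map_mul, letter_of_lt (by omega), wordPerm_of] at hperm
  have hval : ∀ x, (simpleTransposition (m + 2) ⟨m, by omega⟩ (wordPerm (m + 2) l₀ x)).1 = _ :=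
    fun x => congrArg Fin.val (DFunLike.congr_fun hperm x)
  have hrev : ∀ k ≤ m + 1, ∀ x,
      (wordPerm (m + 2) (prefixProd (fun i => letter (m + 2) (m - i)) k) x).1 = _ :=
    fun k hk x => wordPerm_prefixProd_letter_rev (m := m + 1) hk x
  -- The mirror image: the factors from `m - l < m + 1 - k` end in the last two positions, in this
  -- order.
  have hk : wordPerm (m + 2) l₀ ⟨m + 1 - k, by omega⟩ = Fin.last (m + 1) := by
    have h := hval ⟨m + 1 - k, by omega⟩
    rw [simpleTransposition_val, Equiv.Perm.mul_apply, hrev _ (by omega), hrev _ (by omega)] at h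
    ext
    dsimp only [Fin.val_last, Fin.val_castSucc] at h ⊢
    split_ifs at h <;> omega
  have hl' : wordPerm (m + 2) l₀ ⟨m - l, by omega⟩ = (Fin.last m).castSucc := by
    have h := hval ⟨m - l, by omega⟩
    rw [simpleTransposition_val, Equiv.Perm.mul_apply, hrev _ (by omega), hrev _ (by omega)] at h
    ext
    dsimp only [Fin.val_last, Fin.val_castSucc] at h ⊢
    split_ifs at h <;> omega
  have key := coeffFunctor_comp_eq_neg (V := S.V) (M := M) (N := N)
    (f := orderedIncl S.V (m + 2) ≫ (S.wordAction (m + 2) l₀).asHom)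
    (P := fun w => w (Fin.last m).castSucc ≤ w (Fin.last (m + 1)))
    (g := (M ◁ braidGen S.totalBraiding (m + 2) ⟨m, by omega⟩) ▷ N ≫
      coeffTailAct M b (m + 1) ≫ coeffTailAct M b m)
    (g' := coeffTailAct M b (m + 1) ≫ coeffTailAct M b m)
    (by
      intro w hw
      rw [Category.assoc]
      refine S.orderedIncl_wordAction_wordπ l₀ fun hm => hw ?_
      have := hm (show (⟨m - l, by omega⟩ : Fin (m + 2)) ≤ ⟨m + 1 - k, by omega⟩ from
        Fin.le_def.2 (by simp only; omega))
      simpa only [Function.comp_apply, hk, hl'] using this)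
    (by
      intro w hw
      have := congrArg (fun f => (α_ _ _ _).hom ≫ M ◁ f ≫ (α_ _ _ _).inv) (hb.braidGen m w hw)
      simp only [whiskerLeft_neg, whiskerLeft_comp, Preadditive.neg_comp, Preadditive.comp_neg,
        Category.assoc] at this
      simp only [coeffTailAct, Category.assoc, Iso.inv_hom_id_assoc,
        associator_naturality_middle_assoc]
      exact this)
  rw [Functor.map_comp, Category.assoc, Category.assoc] at key
  rw [e, Nat.sub_zero, S.coeffAction_letter M N (by omega)]
  exact key

/-- Only the braid relations and the interchange law enter; this holds for arbitrary morphisms `a`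
and `b` and before restriction to ordered words. -/
theorem front_comp_back (a : M ⊗ (⨁ S.V) ⟶ M) (b : (⨁ S.V) ⊗ N ⟶ N) (m : ℕ) :
    ((coeffFunctor M N).map (S.frontSum (m + 1)) ≫ headAct a (m + 1) ▷ N) ≫
        (coeffFunctor M N).map (S.backSum m) ≫ coeffTailAct M b m =
      ((coeffFunctor M N).map (S.backSum (m + 1)) ≫ coeffTailAct M b (m + 1)) ≫
        (coeffFunctor M N).map (S.frontSum m) ≫ headAct a m ▷ N := by
  rw [coeffFunctor_backSum, coeffFunctor_backSum, coeffFunctor_frontSum, coeffFunctor_frontSum]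
  refine (S.isBraidSeq_coeffAction M N m).sum_comp_sum_comm _ _ _ _ (headAct_tailAct a b m)
    (fun i hi => ?_) fun i hi => S.coeffAction_letter_tailAct M N b hi
  rw [show m - i = (m - 1 - i) + 1 by omega]
  exact S.coeffAction_letter_headAct M N a (by omega)

end BraidedSystem

end

/-! ### Return to ordered tensors and to the differentials -/

section

section Aux

variable {C : Type u} [Category.{v} C] [MonoidalCategory C] {X M N : C}

theorem head_coeff_aux {T A B Y : C} (f : T ⟶ A ⊗ B) (i : A ⟶ 𝟙_ C ⊗ X) (j : B ⟶ Y)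
    (a : M ⊗ X ⟶ M) :
    ((M ◁ f) ▷ N ≫ ((α_ M A B).inv ≫ (M ◁ (i ≫ (λ_ X).hom) ≫ a) ▷ B) ▷ N) ≫ (M ◁ j) ▷ N =
      (M ◁ (f ≫ (i ⊗ₘ j)) ≫ M ◁ ((λ_ X).hom ▷ Y) ≫ (α_ M X Y).inv ≫ a ▷ Y) ▷ N := by
  rw [← comp_whiskerRight, ← comp_whiskerRight]
  congr 1
  simp only [Category.assoc, comp_whiskerRight, ← whisker_exchange]
  rw [MonoidalCategory.tensorHom_def]
  monoidal

theorem tail_coeff_aux {T A B Y : C} (f : T ⟶ B ⊗ A) (i : A ⟶ 𝟙_ C ⊗ X) (j : B ⟶ Y)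
    (b : X ⊗ N ⟶ N) :
    ((M ◁ f) ▷ N ≫ (α_ M B A).inv ▷ N ≫ (α_ (M ⊗ B) A N).hom ≫
        (M ⊗ B) ◁ ((i ≫ (λ_ X).hom) ▷ N ≫ b)) ≫ (M ◁ j) ▷ N =
      (M ◁ (f ≫ (j ⊗ₘ i) ≫ Y ◁ (λ_ X).hom)) ▷ N ≫ (α_ M (Y ⊗ X) N).hom ≫
        M ◁ ((α_ Y X N).hom ≫ Y ◁ b) ≫ (α_ M Y N).inv := by
  simp only [Category.assoc, whisker_exchange]
  rw [MonoidalCategory.tensorHom_def]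
  monoidal

end Aux

variable {C : Type u} [Category.{v} C] [MonoidalCategory C] [Preadditive C] [MonoidalPreadditive C]
  [HasFiniteBiproducts C] {r : ℕ}

theorem RightBraidedModule.ι_act {S : BraidedSystem C r} {M : C} (m : RightBraidedModule S M)
    (i : Fin r) : M ◁ biproduct.ι S.V i ≫ m.act = m.ρ i := by
  rw [act, Preadditive.comp_sum, Finset.sum_eq_single i]
  · rw [← whiskerLeft_comp_assoc, biproduct.ι_π_self, whiskerLeft_id, Category.id_comp]
  · intro j _ hj
    rw [← whiskerLeft_comp_assoc, biproduct.ι_π_ne S.V hj.symm,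
      MonoidalPreadditive.whiskerLeft_zero, zero_comp]
  · simp

theorem LeftBraidedModule.ι_act {S : BraidedSystem C r} {N : C} (l : LeftBraidedModule S N)
    (i : Fin r) : biproduct.ι S.V i ▷ N ≫ l.act = l.lam i := by
  rw [act, Preadditive.comp_sum, Finset.sum_eq_single i]
  · rw [← comp_whiskerRight_assoc, biproduct.ι_π_self, id_whiskerRight, Category.id_comp]
  · intro j _ hj
    rw [← comp_whiskerRight_assoc, biproduct.ι_π_ne S.V hj.symm,
      MonoidalPreadditive.zero_whiskerRight, zero_comp]
  · simp

theorem BraidedSystem.ι_totalBraiding_neg (S : BraidedSystem C r) {i j : Fin r} (h : i ≤ j) :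
    (biproduct.ι S.V i ⊗ₘ biproduct.ι S.V j) ≫ S.neg.totalBraiding =
      -(S.σ i j h ≫ (biproduct.ι S.V j ⊗ₘ biproduct.ι S.V i)) :=
  (S.neg.ι_totalBraiding i j).trans ((dif_pos h).trans (Preadditive.neg_comp _ _))

theorem RightBraidedModule.rightAntiCompat {S : BraidedSystem C r} {M : C}
    (m : RightBraidedModule S M) : RightAntiCompat (V := S.V) S.neg.totalBraiding m.act := by
  -- `S.neg.V` agrees with `S.V` only by unfolding. Replacing the braiding by a variable `c` on `⨁
  -- S.V` keeps the rewriting free of this mismatch.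
  suffices H : ∀ c : (⨁ S.V) ⊗ (⨁ S.V) ⟶ (⨁ S.V) ⊗ (⨁ S.V), (∀ i j (h : i ≤ j),
      (biproduct.ι S.V i ⊗ₘ biproduct.ι S.V j) ≫ c =
        -(S.σ i j h ≫ (biproduct.ι S.V j ⊗ₘ biproduct.ι S.V i))) → RightAntiCompat c m.act from
    H S.neg.totalBraiding fun _ _ h => S.ι_totalBraiding_neg h
  intro c hc i j h
  have e : ∀ i j, M ◁ (biproduct.ι S.V i ⊗ₘ biproduct.ι S.V j) ≫ (α_ _ _ _).inv ≫
      m.act ▷ _ ≫ m.act = (α_ _ _ _).inv ≫ m.ρ i ▷ S.V j ≫ m.ρ j := by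
    intro i j
    rw [← m.ι_act i, ← m.ι_act j, comp_whiskerRight_assoc, ← whisker_exchange_assoc,
      MonoidalCategory.tensorHom_def]
    monoidal
  rw [← whiskerLeft_comp_assoc, hc i j h, whiskerLeft_neg, Preadditive.neg_comp,
    whiskerLeft_comp_assoc, e, e, m.compat i j h, Iso.inv_hom_id_assoc]

theorem LeftBraidedModule.leftAntiCompat {S : BraidedSystem C r} {N : C}
    (l : LeftBraidedModule S N) : LeftAntiCompat (V := S.V) S.neg.totalBraiding l.act := by
  suffices H : ∀ c : (⨁ S.V) ⊗ (⨁ S.V) ⟶ (⨁ S.V) ⊗ (⨁ S.V), (∀ i j (h : i ≤ j),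
      (biproduct.ι S.V i ⊗ₘ biproduct.ι S.V j) ≫ c =
        -(S.σ i j h ≫ (biproduct.ι S.V j ⊗ₘ biproduct.ι S.V i))) → LeftAntiCompat c l.act from
    H S.neg.totalBraiding fun _ _ h => S.ι_totalBraiding_neg h
  intro c hc i j h
  have e : ∀ i j, (biproduct.ι S.V i ⊗ₘ biproduct.ι S.V j) ▷ N ≫ (α_ _ _ _).hom ≫
      _ ◁ l.act ≫ l.act = (α_ _ _ _).hom ≫ S.V i ◁ l.lam j ≫ l.lam i := by
    intro i j
    rw [← l.ι_act i, ← l.ι_act j, whiskerLeft_comp_assoc, whisker_exchange_assoc,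
      MonoidalCategory.tensorHom_def']
    monoidal
  rw [← comp_whiskerRight_assoc, hc i j h, neg_whiskerRight, Preadditive.neg_comp,
    comp_whiskerRight_assoc, e, e, l.compat i j h, Iso.hom_inv_id_assoc]

namespace BraidedSystem

variable (S : BraidedSystem C r)

/-- The coshuffle comultiplication followed by an action of the first factor on `M`. -/
def frontDiff {M : C} (a : M ⊗ (⨁ S.V) ⟶ M) (N : C) (n : ℕ) :
    coeffTensor S.V M N (n + 1) ⟶ coeffTensor S.V M N n :=
  (M ◁ S.coshuffle 1 n (Nat.add_comm 1 n)) ▷ N ≫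
    ((α_ M (orderedTensor S.V 1) (orderedTensor S.V n)).inv ≫
      (M ◁ degreeOne S.V ≫ a) ▷ orderedTensor S.V n) ▷ N

/-- The coshuffle comultiplication followed by an action of the last factor on `N`. -/
def backDiff (M : C) {N : C} (b : (⨁ S.V) ⊗ N ⟶ N) (n : ℕ) :
    coeffTensor S.V M N (n + 1) ⟶ coeffTensor S.V M N n :=
  (M ◁ S.coshuffle n 1 rfl) ▷ N ≫
    (α_ M (orderedTensor S.V n) (orderedTensor S.V 1)).inv ▷ N ≫
      (α_ (M ⊗ orderedTensor S.V n) (orderedTensor S.V 1) N).hom ≫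
        (M ⊗ orderedTensor S.V n) ◁ (degreeOne S.V ▷ N ≫ b)

/-- The inclusion into full tensor powers intertwines the differential with its unprojected version,
so identities can be proved there. -/
theorem frontDiff_incl {M : C} (a : M ⊗ (⨁ S.V) ⟶ M) (N : C) (n : ℕ) :
    S.frontDiff a N n ≫ (coeffFunctor M N).map (orderedIncl S.V n) =
      (coeffFunctor M N).map (orderedIncl S.V (n + 1)) ≫
        (coeffFunctor M N).map (S.frontSum n) ≫ headAct a n ▷ N := by
  refine (head_coeff_aux (S.coshuffle 1 n (Nat.add_comm 1 n)) (orderedIncl S.V 1)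
    (orderedIncl S.V n) a).trans ?_
  rw [coshuffle_one_left, ← tensorPowSplit_head a n]
  simp only [whiskerLeft_comp, comp_whiskerRight, Category.assoc]

theorem backDiff_incl (M : C) {N : C} (b : (⨁ S.V) ⊗ N ⟶ N) (n : ℕ) :
    S.backDiff M b n ≫ (coeffFunctor M N).map (orderedIncl S.V n) =
      (coeffFunctor M N).map (orderedIncl S.V (n + 1)) ≫
        (coeffFunctor M N).map (S.backSum n) ≫ coeffTailAct M b n := by
  refine (tail_coeff_aux (S.coshuffle n 1 rfl) (orderedIncl S.V 1)
    (orderedIncl S.V n) b).trans ?_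
  have e : S.coshuffle n 1 rfl ≫ (orderedIncl S.V n ⊗ₘ orderedIncl S.V 1) ≫
      tensorPow (⨁ S.V) n ◁ (λ_ (⨁ S.V)).hom = orderedIncl S.V (n + 1) ≫ S.backSum n := by
    have h := S.coshuffle_one_right n =≫ (tensorPow (⨁ S.V) n ◁ (λ_ (⨁ S.V)).hom)
    simp only [Category.assoc] at h
    rw [tensorPowSplit_tail] at h
    exact h.trans (congrArg _ (Category.comp_id _))
  rw [e, whiskerLeft_comp, comp_whiskerRight, Category.assoc]
  rfl

theorem coeff_ext {M N A : C} {n : ℕ} {f g : A ⟶ coeffTensor S.V M N n}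
    (h : f ≫ (coeffFunctor M N).map (orderedIncl S.V n) =
      g ≫ (coeffFunctor M N).map (orderedIncl S.V n)) : f = g := by
  have e : (coeffFunctor M N).map (orderedIncl S.V n) ≫
      (coeffFunctor M N).map (orderedProj S.V n) = 𝟙 _ := by
    rw [← Functor.map_comp, orderedIncl_orderedProj, CategoryTheory.Functor.map_id]
  have h' := h =≫ (coeffFunctor M N).map (orderedProj S.V n)
  rw [Category.assoc, Category.assoc, e] at h'
  exact (Category.comp_id f).symm.trans (h'.trans (Category.comp_id g))

theorem frontDiff_comp_frontDiff {M : C} {a : M ⊗ (⨁ S.V) ⟶ M}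
    (ha : RightAntiCompat S.totalBraiding a) (N : C) (n : ℕ) :
    S.frontDiff a N (n + 1) ≫ S.frontDiff a N n = 0 := by
  apply S.coeff_ext
  rw [Category.assoc, frontDiff_incl, ← Category.assoc, frontDiff_incl, zero_comp]
  simpa only [Category.assoc] using S.front_comp_front (N := N) ha n

theorem backDiff_comp_backDiff (M : C) {N : C} {b : (⨁ S.V) ⊗ N ⟶ N}
    (hb : LeftAntiCompat S.totalBraiding b) (n : ℕ) :
    S.backDiff M b (n + 1) ≫ S.backDiff M b n = 0 := by
  apply S.coeff_ext
  rw [Category.assoc, backDiff_incl, ← Category.assoc, backDiff_incl, zero_comp]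
  simpa only [Category.assoc] using S.back_comp_back (M := M) hb n

theorem frontDiff_comp_backDiff {M N : C} (a : M ⊗ (⨁ S.V) ⟶ M) (b : (⨁ S.V) ⊗ N ⟶ N) (n : ℕ) :
    S.frontDiff a N (n + 1) ≫ S.backDiff M b n = S.backDiff M b (n + 1) ≫ S.frontDiff a N n := by
  apply S.coeff_ext
  rw [Category.assoc, Category.assoc, backDiff_incl, frontDiff_incl, ← Category.assoc,
    frontDiff_incl, ← Category.assoc (S.backDiff M b (n + 1)), backDiff_incl]
  have h := (coeffFunctor M N).map (orderedIncl S.V (n + 2)) ≫= S.front_comp_back a b n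
  simpa only [Category.assoc] using h

end BraidedSystem

/-- The signs in consecutive degrees are opposite, so the two mixed composites, equal without signs,
cancel; the square of `d'` is only rescaled. -/
theorem isBidifferential_of_comm {S : BraidedSystem C r} {M N : C}
    {d d' : ∀ n : ℕ, coeffTensor S.V M N (n + 1) ⟶ coeffTensor S.V M N n}
    (hd : ∀ n, d (n + 1) ≫ d n = 0) (hd' : ∀ n, d' (n + 1) ≫ d' n = 0)
    (hdd' : ∀ n, d (n + 1) ≫ d' n = d' (n + 1) ≫ d n) :
    IsBidifferential S M N d fun n => ((-1 : ℤ) ^ n) • d' n := by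
  intro n
  refine ⟨hd n, ?_, ?_⟩
  · rw [Preadditive.zsmul_comp, Preadditive.comp_zsmul, hd', smul_zero, smul_zero]
  · rw [Preadditive.zsmul_comp, Preadditive.comp_zsmul, hdd', ← add_smul, pow_succ]
    simp

theorem isBidifferential {S : BraidedSystem C r} {M N : C} (m : RightBraidedModule S M)
    (l : LeftBraidedModule S N) :
    IsBidifferential S M N (leftDifferential m N) (rightDifferential M l) :=
  isBidifferential_of_comm (S := S) (S.neg.frontDiff_comp_frontDiff m.rightAntiCompat N)
    (S.neg.backDiff_comp_backDiff M l.leftAntiCompat)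
    (S.neg.frontDiff_comp_backDiff (M := M) (N := N) m.act l.act)

theorem IsBidifferential.isDifferential {S : BraidedSystem C r} {M N : C}
    {d d' : ∀ n : ℕ, coeffTensor S.V M N (n + 1) ⟶ coeffTensor S.V M N n}
    (h : IsBidifferential S M N d d') (a b : ℤ) :
    IsDifferential S M N fun n => a • d n + b • d' n := by
  intro n
  obtain ⟨h1, h2, h3⟩ := h n
  have h3' := eq_neg_of_add_eq_zero_right h3
  simp only [Preadditive.add_comp, Preadditive.comp_add, Preadditive.zsmul_comp,
    Preadditive.comp_zsmul, h1, h2, h3', smul_zero, zero_add, add_zero, smul_neg]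
  rw [smul_comm b a, neg_add_cancel]

end

end MultiBraided

end

theorem mainTheorem4 {C : Type*} [Category* C] [MonoidalCategory C] [Preadditive C]
    [MonoidalPreadditive C] [HasFiniteBiproducts C] {r : ℕ}
    (S : MultiBraided.BraidedSystem C r) (M N : C)
    (m : MultiBraided.RightBraidedModule S M) (l : MultiBraided.LeftBraidedModule S N) :
    MultiBraided.IsBidifferential S M N
        (MultiBraided.leftDifferential m N) (MultiBraided.rightDifferential M l) ∧
      ∀ a b : ℤ, MultiBraided.IsDifferential S M N fun n =>
        a • MultiBraided.leftDifferential m N n + b • MultiBraided.rightDifferential M l n :=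
  ⟨MultiBraided.isBidifferential m l, (MultiBraided.isBidifferential m l).isDifferential⟩
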